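/- **Definitions.** All graphs are finite and simple. A *2-factor* of a graph $G$ is a spanning subgraph of $G$ in which every vertex has degree $2$; a 2-factor is *odd* if all its cycles have odd length. Two edges are *independent* if they have no common end. A pair of independent edges $f=ab$, $g=cd$ of a graph $R$ is a *gadget-pair* of $R$ if 1. no 2-factor of $R$ avoids both $f$ and $g$; 2. every 2-factor of $R$ containing exactly one of $f,g$ is odd; 3. every 2-factor of $R$ containing both $f$ and $g$ is odd, and $f$ and $g$ lie on different cycles of it; 4. in every 2-factor of $(R-\{f,g\})\cup\{ac,ad,bc,bd\}$ that contains exactly one edge $e$ of $\{ac,ad,bc,bd\}$, the cycle containing $e$ has even length and all other cycles have odd length. The graph $P_{18}$ (the snark Blanuša 2) has vertex set $\{1,\dots,18\}$ and edges (1,2), (1,4), (2,3), (2,6), (3,8), (4,5), (4,8), (5,6), (6,7), (7,8), (9,10), (9,14), (10,11), (10,12), (11,18), (12,13), (12,16), (13,14), (13,18), (14,15), (15,16), (16,17), (17,18), (1,9), (5,15), (7,17), (3,11). The graph $P_{26}$ has vertex set $\{1,\dots,26\}$ and edges (1,2), (2,3), (4,5), (5,6), (2,5), (7,8), (7,12),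 (8,9), (8,10), (9,16), (10,11), (10,14), (11,12), (11,16), (12,13), (13,14), (14,15), (15,16), (1,7), (3,13), (6,15), (4,9), (17,18), (17,22), (18,19), (18,20), (19,26), (20,21), (20,24), (21,22), (21,26), (22,23), (23,24), (24,25), (25,26), (3,17), (6,25), (4,23), (1,19). The graph $P_{34}$ has vertex set $\{1,\dots,34\}$ and edges (5,6), (5,10), (6,7), (6,8), (7,14), (8,9), (8,12), (9,10), (9,14), (10,11), (11,12), (12,13), (13,14), (1,5), (4,11), (3,13), (2,7), (15,16), (15,20), (16,17), (16,18), (17,24), (18,19), (18,22), (19,20), (19,24), (20,21), (21,22), (22,23), (23,24), (4,15), (3,23), (2,21), (1,17), (25,26), (25,34), (26,27), (26,28), (27,30), (28,29), (28,32), (29,30), (29,34), (30,31), (31,32), (32,33), (33,34), (2,33), (3,27), (4,31), (1,25). For odd $t\ge 5$ the *Flower snark* $J(t)$ has vertex set $\{h_i,u_i,v_i,w_i : 1\le i\le t\}$ and edge set $$\{h_iu_i,\,h_iv_i,\,h_iw_i : 1\le i\le t\}\ \cup\ \{u_ju_{j+1},\,v_jv_{j+1},\,w_jw_{j+1} : 1\le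 j\le t-1\}\ \cup\ \{u_tv_1,\,v_tu_1,\,w_tw_1\}.$$ **Lemma.** (i) None of the snarks $P_{18}$, $P_{26}$, $P_{34}$ has a gadget-pair. (ii) For every odd $t\ge 5$, the Flower snark $J(t)$ has no gadget-pair. -/

import Mathlib

namespace OddTwoFactor

/-- `F` is a 2-factor of `G`: a spanning subgraph of `G` in which every vertex has degree 2.
It is recorded by its edges, as a simple graph on the same vertex set. -/
def IsTwoFactor {V : Type*} (G F : SimpleGraph V) : Prop :=
  F ≤ G ∧ ∀ v : V, (F.neighborSet v).ncard = 2

/-- Every cycle of `F` has odd length. -/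
def AllCyclesOdd {V : Type*} (F : SimpleGraph V) : Prop :=
  ∀ (v : V) (p : F.Walk v v), p.IsCycle → Odd p.length

/-- The four possible edges joining an end of `ab` to an end of `cd`. -/
def crossEdges {V : Type*} (a b c d : V) : Set (Sym2 V) :=
  {s(a, c), s(a, d), s(b, c), s(b, d)}

/-- The graph `(R - {ab, cd}) ∪ {ac, ad, bc, bd}`. -/
def exchange {V : Type*} (R : SimpleGraph V) (a b c d : V) : SimpleGraph V :=
  R.deleteEdges {s(a, b), s(c, d)} ⊔ SimpleGraph.fromEdgeSet (crossEdges a b c d)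

/-- `ab` and `cd` form a gadget-pair of `R`. -/
structure IsGadgetPair {V : Type*} (R : SimpleGraph V) (a b c d : V) : Prop where
  adj_ab : R.Adj a b
  adj_cd : R.Adj c d
  /-- The two edges have no common end. -/
  independent : a ≠ c ∧ a ≠ d ∧ b ≠ c ∧ b ≠ d
  /-- No 2-factor avoids both edges. -/
  not_avoid : ∀ F : SimpleGraph V, IsTwoFactor R F →
    ¬ (s(a, b) ∉ F.edgeSet ∧ s(c, d) ∉ F.edgeSet)
  /-- All 2-factors with exactly one of the two edges are odd. -/
  exactly_one : ∀ F : SimpleGraph V, IsTwoFactor R F →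
    Xor (s(a, b) ∈ F.edgeSet) (s(c, d) ∈ F.edgeSet) → AllCyclesOdd F
  /-- All 2-factors with both edges are odd, and have the two edges on different cycles. -/
  both : ∀ F : SimpleGraph V, IsTwoFactor R F →
    s(a, b) ∈ F.edgeSet → s(c, d) ∈ F.edgeSet →
      AllCyclesOdd F ∧
      ∀ (v : V) (p : F.Walk v v), p.IsCycle → ¬ (s(a, b) ∈ p.edges ∧ s(c, d) ∈ p.edges)
  /-- In a 2-factor of the exchanged graph with exactly one cross edge `e`,
  the cycle through `e` is even and all other cycles are odd. -/
  cross : ∀ F : SimpleGraph V, IsTwoFactor (exchange R a b c d) F →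
    ∀ e : Sym2 V, F.edgeSet ∩ crossEdges a b c d = {e} →
      ∀ (v : V) (p : F.Walk v v), p.IsCycle →
        (e ∈ p.edges → Even p.length) ∧ (e ∉ p.edges → Odd p.length)

/-- `R` has a gadget-pair. -/
def HasGadgetPair {V : Type*} (R : SimpleGraph V) : Prop :=
  ∃ a b c d : V, IsGadgetPair R a b c d

/-- The graph with vertices labelled `1, …, n` (the vertex `i : Fin n` carries the label `i + 1`)
whose edges are the pairs of labels in `E`. -/
def labelledGraph (n : ℕ) (E : List (ℕ × ℕ)) : SimpleGraph (Fin n) :=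
  SimpleGraph.fromRel fun i j => (i.val + 1, j.val + 1) ∈ E

/-- The snark `P₁₈` (Blanuša 2), a dot product of two Petersen graphs. The first line is the
Petersen graph minus two adjacent vertices, the next two lines the Petersen graph minus two
independent edges, and the last line the four joining edges. -/
def P18 : SimpleGraph (Fin 18) :=
  labelledGraph 18
    [(1, 2), (1, 4), (2, 3), (2, 6), (3, 8), (4, 5), (4, 8), (5, 6), (6, 7), (7, 8),
     (9, 10), (9, 14), (10, 11), (10, 12), (11, 18), (12, 13), (12, 16), (13, 14), (13, 18),
     (14, 15), (15, 16), (16, 17), (17, 18),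
     (1, 9), (5, 15), (7, 17), (3, 11)]

/-- The snark `P₂₆`, a dot product of `P₁₈` and the Petersen graph. -/
def P26 : SimpleGraph (Fin 26) :=
  labelledGraph 26
    [(1, 2), (2, 3), (4, 5), (5, 6), (2, 5),
     (7, 8), (7, 12), (8, 9), (8, 10), (9, 16), (10, 11), (10, 14), (11, 12), (11, 16),
     (12, 13), (13, 14), (14, 15), (15, 16),
     (1, 7), (3, 13), (6, 15), (4, 9),
     (17, 18), (17, 22), (18, 19), (18, 20), (19, 26), (20, 21), (20, 24), (21, 22), (21, 26),
     (22, 23), (23, 24), (24, 25), (25, 26),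
     (17, 3), (25, 6), (23, 4), (1, 19)]

/-- The snark `P₃₄`, a dot product of `P₂₆` and the Petersen graph. -/
def P34 : SimpleGraph (Fin 34) :=
  labelledGraph 34
    [(5, 6), (5, 10), (6, 7), (6, 8), (7, 14), (8, 9), (8, 12), (9, 10), (9, 14), (10, 11),
     (11, 12), (12, 13), (13, 14),
     (1, 5), (4, 11), (3, 13), (2, 7),
     (15, 16), (15, 20), (16, 17), (16, 18), (17, 24), (18, 19), (18, 22), (19, 20), (19, 24),
     (20, 21), (21, 22), (22, 23), (23, 24),
     (15, 4), (23, 3), (21, 2), (1, 17),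
     (25, 26), (25, 34), (26, 27), (26, 28), (27, 30), (28, 29), (28, 32), (29, 30), (29, 34),
     (30, 31), (31, 32), (32, 33), (33, 34),
     (33, 2), (27, 3), (31, 4), (1, 25)]

/-- The vertices `h_i, u_i, v_i, w_i` of the Flower snark `J(t)`; the index set
`{1, …, t}` is shifted to `{0, …, t - 1}`. -/
inductive FlowerVertex (t : ℕ) : Type
  | h (i : Fin t)
  | u (i : Fin t)
  | v (i : Fin t)
  | w (i : Fin t)

/-- The edges of the Flower snark, each in one orientation: spokes, links between consecutive
interchanges, and the twisted link from the last interchange back to the first. -/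
inductive FlowerEdge (t : ℕ) : FlowerVertex t → FlowerVertex t → Prop
  | hu (i : Fin t) : FlowerEdge t (.h i) (.u i)
  | hv (i : Fin t) : FlowerEdge t (.h i) (.v i)
  | hw (i : Fin t) : FlowerEdge t (.h i) (.w i)
  | uu (i j : Fin t) : i.val + 1 = j.val → FlowerEdge t (.u i) (.u j)
  | vv (i j : Fin t) : i.val + 1 = j.val → FlowerEdge t (.v i) (.v j)
  | ww (i j : Fin t) : i.val + 1 = j.val → FlowerEdge t (.w i) (.w j)
  | uv (i j : Fin t) : i.val + 1 = t → j.val = 0 → FlowerEdge t (.u i) (.v j)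
  | vu (i j : Fin t) : i.val + 1 = t → j.val = 0 → FlowerEdge t (.v i) (.u j)
  | wrap (i j : Fin t) : i.val + 1 = t → j.val = 0 → FlowerEdge t (.w i) (.w j)

/-- The Flower snark `J(t)` (intended for odd `t ≥ 5`). -/
def flowerSnark (t : ℕ) : SimpleGraph (FlowerVertex t) :=
  SimpleGraph.fromRel (FlowerEdge t)

end OddTwoFactor

/-! Every pair of independent edges is shown to violate `not_avoid`, `both` or `cross`.

For the three fixed snarks this is a finite check. A 2-factor is encoded by a table of successors
along its oriented cycles. A short list of tables contains, for almost every pair, a 2-factor that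
avoids both edges or has both on one cycle. The few other pairs are refuted by a 2-factor of the
exchanged graph whose only cross edge lies on an odd cycle.

The Flower snark is a ring of claws, with three links in each gap between consecutive claws. Choose
one link in every gap so that the links entering and leaving a claw use different ends of it.
Together with the spoke at the third end of each claw they form a perfect matching, whose complement
is a 2-factor (`isTwoFactor_ringSubgraph`). Since the two neighbouring gaps exclude at most two of
three strands, partial choices extend (`ProperOn.exists_extension`). Hence two independent edges lie
in such a matching, and its complement avoids both, unless they are links of the same gap.

For two links of one gap, the cross edge between their ends at one claw forms a triangle with the
hub. The rest of the ring is completed to a 2-factor by gaps keeping alternately one and three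
links, with two one-link gaps in succession around the triangle. This pattern closes up because t is
odd (`hasAlternatingSets_addRight_one`). -/

namespace OddTwoFactor

/-! ### Symmetries of the gadget-pair conditions -/

section Symmetry

variable {V : Type*} {R : SimpleGraph V} {a b c d : V}

theorem crossEdges_swap_left : crossEdges b a c d = crossEdges a b c d := by
  ext e; simp only [crossEdges, Set.mem_insert_iff, Set.mem_singleton_iff]; tauto

theorem crossEdges_comm : crossEdges c d a b = crossEdges a b c d := by
  ext e
  simp only [crossEdges, Set.mem_insert_iff, Set.mem_singleton_iff, Sym2.eq_swap (a := c),
    Sym2.eq_swap (a := d)]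
  tauto

theorem exchange_swap_left : exchange R b a c d = exchange R a b c d := by
  rw [exchange, crossEdges_swap_left, Sym2.eq_swap, ← exchange]

theorem exchange_comm : exchange R c d a b = exchange R a b c d := by
  rw [exchange, crossEdges_comm, Set.pair_comm, ← exchange]

/-- The ends of an edge come in an order; this symmetry and the next two allow each edge to be taken
in the orientation in which the edge list or relation supplies it. -/
theorem IsGadgetPair.swap_left (h : IsGadgetPair R a b c d) : IsGadgetPair R b a c d where
  adj_ab := h.adj_ab.symm
  adj_cd := h.adj_cd
  independent := by have := h.independent; tauto
  not_avoid := by rw [Sym2.eq_swap]; exact h.not_avoid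
  exactly_one := by rw [Sym2.eq_swap]; exact h.exactly_one
  both := by rw [Sym2.eq_swap]; exact h.both
  cross := by rw [exchange_swap_left, crossEdges_swap_left]; exact h.cross

theorem IsGadgetPair.symm (h : IsGadgetPair R a b c d) : IsGadgetPair R c d a b where
  adj_ab := h.adj_cd
  adj_cd := h.adj_ab
  independent := by have := h.independent; simp only [ne_comm (a := c), ne_comm (a := d)]; tauto
  not_avoid F hF := fun hn => h.not_avoid F hF hn.symm
  exactly_one F hF := fun hx => h.exactly_one F hF (by rwa [xor_comm])
  both F hF hc ha :=
    ⟨(h.both F hF ha hc).1, fun v p hp hn => (h.both F hF ha hc).2 v p hp hn.symm⟩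
  cross := by rw [exchange_comm, crossEdges_comm]; exact h.cross

theorem IsGadgetPair.swap_right (h : IsGadgetPair R a b c d) : IsGadgetPair R a b d c :=
  h.symm.swap_left.symm

end Symmetry

/-! ### 2-factors given by a successor map -/

section CycleGraph

variable {V : Type*} {f : V → V}

open Function

/-- The union of the cycles of `f`: every vertex is joined to its successor `f v`. -/
def cycleGraphOf (f : V → V) (hf : ∀ v, f v ≠ v) : SimpleGraph V where
  Adj v w := f v = w ∨ f w = v
  symm := ⟨fun _ _ h => h.symm⟩
  loopless := ⟨fun v h => hf v (h.elim id id)⟩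

theorem cycleGraphOf_adj_apply (hf : ∀ v, f v ≠ v) (v : V) : (cycleGraphOf f hf).Adj v (f v) :=
  Or.inl rfl

/-- On a finite set injectivity provides a predecessor, and the absence of 2-cycles separates it
from the successor. -/
theorem ncard_neighborSet_cycleGraphOf [Finite V] (hf : ∀ v, f v ≠ v) (hinj : Injective f)
    (hf2 : ∀ v, f (f v) ≠ v) (v : V) : ((cycleGraphOf f hf).neighborSet v).ncard = 2 := by
  obtain ⟨u, rfl⟩ := (Finite.injective_iff_surjective.1 hinj) v
  rw [Set.ncard_eq_two]
  refine ⟨f (f u), u, hf2 u, ?_⟩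
  ext w
  simp only [SimpleGraph.mem_neighborSet, cycleGraphOf, Set.mem_insert_iff,
    Set.mem_singleton_iff, hinj.eq_iff]
  rw [eq_comm]

theorem isTwoFactor_cycleGraphOf [Finite V] {G : SimpleGraph V} (hG : ∀ v, G.Adj v (f v))
    (hf : ∀ v, f v ≠ v) (hinj : Injective f) (hf2 : ∀ v, f (f v) ≠ v) :
    IsTwoFactor G (cycleGraphOf f hf) := by
  refine ⟨?_, ncard_neighborSet_cycleGraphOf hf hinj hf2⟩
  rintro v w (rfl | rfl)
  exacts [hG _, (hG _).symm]

/-- The walk `v, f v, f (f v), …` of length `n`. -/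
def iterateWalk {G : SimpleGraph V} (hG : ∀ v, G.Adj v (f v)) : ∀ (n : ℕ) (v : V),
    G.Walk v (f^[n] v)
  | 0, _ => .nil
  | n + 1, v => .cons (hG v) (iterateWalk hG n (f v))

variable {G : SimpleGraph V}

theorem length_iterateWalk (hG : ∀ v, G.Adj v (f v)) (n : ℕ) (v : V) :
    (iterateWalk hG n v).length = n := by
  induction n generalizing v with
  | zero => rfl
  | succ n ih => exact congrArg (· + 1) (ih (f v))

theorem support_iterateWalk (hG : ∀ v, G.Adj v (f v)) (n : ℕ) (v : V) :
    (iterateWalk hG n v).support = List.iterate f v (n + 1) := by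
  induction n generalizing v with
  | zero => rfl
  | succ n ih => exact congrArg (v :: ·) (ih (f v))

theorem mem_edges_iterateWalk (hG : ∀ v, G.Adj v (f v)) {n i : ℕ} (hi : i < n) (v : V) :
    s(f^[i] v, f^[i + 1] v) ∈ (iterateWalk hG n v).edges := by
  induction n generalizing v i with
  | zero => omega
  | succ n ih =>
    cases i with
    | zero => exact List.mem_cons_self
    | succ i => exact List.mem_cons_of_mem _ (ih (by omega) (f v))

theorem nodup_iterate {n : ℕ} {v : V} (hn : n ≤ minimalPeriod f v) :
    (List.iterate f v n).Nodup := by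
  rw [List.nodup_iff_injective_get]
  intro i j hij
  simp only [List.get_eq_getElem, List.getElem_iterate] at hij
  have hi : (i : ℕ) < n := i.2.trans_eq (List.length_iterate ..)
  have hj : (j : ℕ) < n := j.2.trans_eq (List.length_iterate ..)
  exact Fin.ext (iterate_injOn_Iio_minimalPeriod (hi.trans_le hn) (hj.trans_le hn) hij)

theorem exists_isCycle [Finite V] (hG : ∀ v, G.Adj v (f v)) (hinj : Injective f)
    (hf2 : ∀ v, f (f v) ≠ v) (v : V) : ∃ (u : V) (p : G.Walk u u), p.IsCycle ∧
      p.length = minimalPeriod f v ∧ ∀ i, s(f^[i] v, f^[i + 1] v) ∈ p.edges := by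
  have hpos : 0 < minimalPeriod f v := minimalPeriod_pos_of_mem_periodicPts (hinj.mem_periodicPts v)
  have h1 : minimalPeriod f v ≠ 1 := fun h =>
    (hG v).ne (minimalPeriod_eq_one_iff_isFixedPt.1 h).symm
  have h2 : minimalPeriod f v ≠ 2 := fun h => hf2 v (by
    have := iterate_minimalPeriod (f := f) (x := v); rwa [h] at this)
  obtain ⟨n, hn⟩ : ∃ n, minimalPeriod f v = n + 1 := ⟨_, (Nat.sub_add_cancel hpos).symm⟩
  have hlast : f (f^[n] v) = v := by
    rw [← iterate_succ_apply' f, Nat.succ_eq_add_one, ← hn]; exact iterate_minimalPeriod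
  have hadj : G.Adj (f^[n] v) v := by simpa only [hlast] using hG (f^[n] v)
  -- The closing edge is put first, so that the tail of the closed walk is the path of the first `n
  -- + 1` iterates, which are distinct.
  refine ⟨_, .cons hadj (iterateWalk hG n v), ?_, ?_, fun i => ?_⟩
  · rw [SimpleGraph.Walk.isCycle_iff_isPath_tail_and_le_length]
    refine ⟨?_, by rw [SimpleGraph.Walk.length_cons, length_iterateWalk]; omega⟩
    have hpath : (iterateWalk hG n v).IsPath := by
      rw [SimpleGraph.Walk.isPath_def, support_iterateWalk]
      exact nodup_iterate hn.ge
    rw [SimpleGraph.Walk.tail_cons]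
    exact (SimpleGraph.Walk.isPath_copy ..).2 hpath
  · rw [SimpleGraph.Walk.length_cons, length_iterateWalk, hn]
  · have hmod : f^[i % minimalPeriod f v] v = f^[i] v := iterate_mod_minimalPeriod_eq
    rw [iterate_succ_apply', ← hmod]
    have hlt := Nat.mod_lt i hpos
    rw [SimpleGraph.Walk.edges_cons]
    rcases (show i % minimalPeriod f v < n ∨ i % minimalPeriod f v = n by omega) with h | h
    · rw [← iterate_succ_apply' f]
      exact List.mem_cons_of_mem _ (mem_edges_iterateWalk hG h v)
    · rw [h, hlast]
      exact List.mem_cons_self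

end CycleGraph

/-! ### Certificates in the form of successor tables -/

section SuccTable

variable {n : ℕ} [NeZero n]

/-- The vertex of `Fin n` with the given label in `{1, …, n}`. -/
def ofLabel (n : ℕ) [NeZero n] (k : ℕ) : Fin n := Fin.ofNat n (k - 1)

theorem ofLabel_val_add_one (i : Fin n) : ofLabel n (i.val + 1) = i := by
  simp [ofLabel]

/-- The map sending the vertex labelled `k` to the vertex labelled by the `k`-th entry of `L`. -/
def tableSucc (n : ℕ) [NeZero n] (L : List ℕ) (v : Fin n) : Fin n := ofLabel n (L.getD v 0)

/-- `L` lists the successors of the vertices of `G` along the cycles of a 2-factor. -/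
def IsSuccTable (G : SimpleGraph (Fin n)) (L : List ℕ) : Prop :=
  (∀ v, G.Adj v (tableSucc n L v)) ∧ (∀ v, tableSucc n L (tableSucc n L v) ≠ v) ∧
    Function.Injective (tableSucc n L)

instance {G : SimpleGraph (Fin n)} [DecidableRel G.Adj] {L : List ℕ} :
    Decidable (IsSuccTable G L) :=
  inferInstanceAs (Decidable (_ ∧ _ ∧ _))

/-- The edges `ab` and `cd` are avoided by the 2-factor with successor table `L`. -/
def TableAvoids (L : List ℕ) (a b c d : Fin n) : Prop :=
  tableSucc n L a ≠ b ∧ tableSucc n L b ≠ a ∧ tableSucc n L c ≠ d ∧ tableSucc n L d ≠ c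

instance {L : List ℕ} {a b c d : Fin n} : Decidable (TableAvoids L a b c d) :=
  inferInstanceAs (Decidable (_ ∧ _ ∧ _ ∧ _))

/-- The edges `ab` and `cd` lie on one cycle of the 2-factor with successor table `L`. -/
def TableSameCycle (L : List ℕ) (a b c d : Fin n) : Prop :=
  ∃ e ∈ [(a, b), (b, a)], tableSucc n L e.1 = e.2 ∧ ∃ f ∈ [(c, d), (d, c)],
    tableSucc n L f.1 = f.2 ∧ f.1 ∈ List.iterate (tableSucc n L) e.1 n

instance {L : List ℕ} {a b c d : Fin n} : Decidable (TableSameCycle L a b c d) :=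
  inferInstanceAs (Decidable (∃ e ∈ [(a, b), (b, a)], _))

/-- `L` is the successor table of a 2-factor of `exchange G a b c d`, in which the arc from `v`
to its successor is the only cross edge and lies on a cycle of length dividing the odd
number `k`. -/
def IsOddCrossTable (G : SimpleGraph (Fin n)) (L : List ℕ) (a b c d v : Fin n) (k : ℕ) : Prop :=
  IsSuccTable (exchange G a b c d) L ∧ v ∈ [a, b] ∧ tableSucc n L v ∈ [c, d] ∧
    (∀ x ∈ [a, b], ∀ y ∈ [c, d], tableSucc n L x = y ∨ tableSucc n L y = x →
      x = v ∧ y = tableSucc n L v) ∧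
    (tableSucc n L)^[k] v = v ∧ k % 2 = 1

theorem exchange_adj {V : Type*} {R : SimpleGraph V} {a b c d v w : V} :
    (exchange R a b c d).Adj v w ↔
      (R.Adj v w ∧ s(v, w) ≠ s(a, b) ∧ s(v, w) ≠ s(c, d)) ∨
        (s(v, w) = s(a, c) ∨ s(v, w) = s(a, d) ∨ s(v, w) = s(b, c) ∨ s(v, w) = s(b, d)) ∧
          v ≠ w := by
  rw [exchange, SimpleGraph.sup_adj, SimpleGraph.deleteEdges_adj, SimpleGraph.fromEdgeSet_adj]
  simp only [crossEdges, Set.mem_insert_iff, Set.mem_singleton_iff, not_or]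

instance {V : Type*} [DecidableEq V] {R : SimpleGraph V} [DecidableRel R.Adj] {a b c d : V} :
    DecidableRel (exchange R a b c d).Adj :=
  fun _ _ => decidable_of_iff' _ exchange_adj

instance {G : SimpleGraph (Fin n)} [DecidableRel G.Adj] {L : List ℕ} {a b c d v : Fin n} {k : ℕ} :
    Decidable (IsOddCrossTable G L a b c d v k) :=
  @instDecidableAnd _ _ inferInstance inferInstance

instance {E : List (ℕ × ℕ)} : DecidableRel (labelledGraph n E).Adj :=
  fun i j => decidable_of_iff' (i ≠ j ∧ ((i.val + 1, j.val + 1) ∈ E ∨ (j.val + 1, i.val + 1) ∈ E))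
    (SimpleGraph.fromRel_adj ..)

variable {G : SimpleGraph (Fin n)} {L : List ℕ} {a b c d : Fin n}

theorem IsSuccTable.ne (h : IsSuccTable G L) (v : Fin n) : tableSucc n L v ≠ v :=
  (h.1 v).ne'

theorem IsSuccTable.isTwoFactor (h : IsSuccTable G L) :
    IsTwoFactor G (cycleGraphOf (tableSucc n L) h.ne) :=
  isTwoFactor_cycleGraphOf h.1 h.ne h.2.2 h.2.1

theorem IsSuccTable.not_isGadgetPair_of_avoids (h : IsSuccTable G L)
    (hL : TableAvoids L a b c d) : ¬ IsGadgetPair G a b c d := fun hg =>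
  hg.not_avoid _ h.isTwoFactor
    ⟨fun hab => hab.elim hL.1 hL.2.1, fun hcd => hcd.elim hL.2.2.1 hL.2.2.2⟩

theorem IsSuccTable.not_isGadgetPair_of_sameCycle (h : IsSuccTable G L)
    (hL : TableSameCycle L a b c d) : ¬ IsGadgetPair G a b c d := by
  intro hg
  obtain ⟨⟨v, v'⟩, hab, hv', ⟨u, u'⟩, hcd, hu', hvu⟩ := hL
  dsimp only at hv' hu' hvu
  subst hv' hu'
  -- The arc at `u` is the `i`-th arc of the orbit of `v`, so `exists_isCycle` puts both edges on
  -- one cycle.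
  obtain ⟨i, -, rfl : u = _⟩ := List.mem_iterate.1 hvu
  have hv : s(v, tableSucc n L v) = s(a, b) := by
    simpa only [List.mem_cons, List.not_mem_nil, or_false, Prod.mk.injEq, Sym2.eq_iff] using hab
  have hu : s((tableSucc n L)^[i] v, tableSucc n L ((tableSucc n L)^[i] v)) = s(c, d) := by
    simpa only [List.mem_cons, List.not_mem_nil, or_false, Prod.mk.injEq, Sym2.eq_iff] using hcd
  have hadj := cycleGraphOf_adj_apply h.ne
  obtain ⟨w, p, hp, -, hedge⟩ := exists_isCycle hadj h.2.2 h.2.1 v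
  refine (hg.both _ h.isTwoFactor ?_ ?_).2 w p hp ⟨?_, ?_⟩
  · rw [← hv]; exact hadj _
  · rw [← hu]; exact hadj _
  · rw [← hv]; exact hedge 0
  · rw [← hu, ← Function.iterate_succ_apply' (tableSucc n L)]; exact hedge i

/-- The length of the cycle is the minimal period of `v`, which divides the odd number `k`; `cross`
would make it even. -/
theorem IsOddCrossTable.not_isGadgetPair {v : Fin n} {k : ℕ}
    (h : IsOddCrossTable G L a b c d v k) : ¬ IsGadgetPair G a b c d := by
  intro hg
  obtain ⟨hs, hv, hsv, huniq, hper, hk⟩ := h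
  have hadj := cycleGraphOf_adj_apply hs.ne
  obtain ⟨w, p, hp, hlen, hedge⟩ := exists_isCycle hadj hs.2.2 hs.2.1 v
  have hodd : Odd p.length := by
    rw [hlen]
    exact (Nat.odd_iff.2 hk).of_dvd_nat (Function.IsPeriodicPt.minimalPeriod_dvd hper)
  refine Nat.not_even_iff_odd.2 hodd ((hg.cross _ hs.isTwoFactor s(v, tableSucc n L v) ?_ w p hp).1
    (hedge 0))
  have hcross (e : Sym2 (Fin n)) : e ∈ crossEdges a b c d ↔ ∃ x ∈ [a, b], ∃ y ∈ [c, d],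
      e = s(x, y) := by
    simp [crossEdges, or_assoc]
  ext e
  rw [Set.mem_inter_iff, hcross, Set.mem_singleton_iff]
  constructor
  · rintro ⟨he, x, hx, y, hy, rfl⟩
    obtain ⟨rfl, rfl⟩ := huniq x hx y hy he
    rfl
  · rintro rfl
    exact ⟨hadj v, v, hv, _, hsv, rfl⟩

end SuccTable

/-! ### The three fixed snarks -/

/-- A labelled graph has no gadget-pair if every pair of its independent edges is avoided by, or on
a cycle of, one of the 2-factors in `T`, or violates the condition on cross edges by a 2-factor
in `X`, whose entries are a pair of edges, the first end of the cross edge, a multiple of the length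
of its cycle, and a successor table. -/
theorem not_hasGadgetPair_labelledGraph {n : ℕ} [NeZero n] {E : List (ℕ × ℕ)} (T : List (List ℕ))
    (X : List ((ℕ × ℕ) × (ℕ × ℕ) × ℕ × ℕ × List ℕ))
    (hT : ∀ L ∈ T, IsSuccTable (labelledGraph n E) L)
    (hX : ∀ x ∈ X, IsOddCrossTable (labelledGraph n E) x.2.2.2.2 (ofLabel n x.1.1) (ofLabel n x.1.2)
      (ofLabel n x.2.1.1) (ofLabel n x.2.1.2) (ofLabel n x.2.2.1) x.2.2.2.1)
    (hE : E.Pairwise fun f g =>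
      ¬ (f.1 ≠ g.1 ∧ f.1 ≠ g.2 ∧ f.2 ≠ g.1 ∧ f.2 ≠ g.2) ∨
      (∃ L ∈ T, TableAvoids L (ofLabel n f.1) (ofLabel n f.2) (ofLabel n g.1) (ofLabel n g.2)) ∨
      (∃ L ∈ T, TableSameCycle L (ofLabel n f.1) (ofLabel n f.2) (ofLabel n g.1) (ofLabel n g.2)) ∨
      ∃ x ∈ X, x.1 = f ∧ x.2.1 = g) :
    ¬ HasGadgetPair (labelledGraph n E) := by
  have key : ∀ f ∈ E, ∀ g ∈ E, ¬ IsGadgetPair (labelledGraph n E)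
      (ofLabel n f.1) (ofLabel n f.2) (ofLabel n g.1) (ofLabel n g.2) := by
    intro f hf g hg
    -- `S` is symmetric, and holds on the diagonal because an edge is not independent of itself; so
    -- checking each unordered pair of list entries once is enough.
    let S (f g : ℕ × ℕ) : Prop := ¬ IsGadgetPair (labelledGraph n E) (ofLabel n f.1)
      (ofLabel n f.2) (ofLabel n g.1) (ofLabel n g.2)
    have : Std.Symm S := ⟨fun f g h h' => h h'.symm⟩
    refine List.Pairwise.forall_of_forall (R := S) (fun f _ => ?_) ?_ hf hg
    · exact fun h => h.independent.1 rfl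
    refine hE.imp ?_
    rintro f g (h | ⟨L, hL, h⟩ | ⟨L, hL, h⟩ | ⟨x, hx, rfl, rfl⟩)
    · intro hg
      refine h ⟨fun h' => ?_, fun h' => ?_, fun h' => ?_, fun h' => ?_⟩
      · exact hg.independent.1 (by rw [h'])
      · exact hg.independent.2.1 (by rw [h'])
      · exact hg.independent.2.2.1 (by rw [h'])
      · exact hg.independent.2.2.2 (by rw [h'])
    · exact (hT L hL).not_isGadgetPair_of_avoids h
    · exact (hT L hL).not_isGadgetPair_of_sameCycle h
    · exact (hX x hx).not_isGadgetPair
  rintro ⟨a, b, c, d, h⟩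
  obtain ⟨-, hab⟩ := (SimpleGraph.fromRel_adj _ _ _).1 h.adj_ab
  obtain ⟨-, hcd⟩ := (SimpleGraph.fromRel_adj _ _ _).1 h.adj_cd
  have key' {x y z w : Fin n} (hxy : (x.val + 1, y.val + 1) ∈ E)
      (hzw : (z.val + 1, w.val + 1) ∈ E) : ¬ IsGadgetPair (labelledGraph n E) x y z w := by
    have := key _ hxy _ hzw
    simpa only [ofLabel_val_add_one] using this
  rcases hab with hab | hab <;> rcases hcd with hcd | hcd
  · exact key' hab hcd h
  · exact key' hab hcd h.swap_right
  · exact key' hab hcd h.swap_left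
  · exact key' hab hcd h.swap_left.swap_right

/-- In each of the three snarks, the exchange certificates treat the three pairs formed by three
mutually independent edges, and the first list settles all other pairs. -/
theorem not_hasGadgetPair_P18 : ¬ HasGadgetPair P18 :=
  not_hasGadgetPair_labelledGraph
    [[4, 1, 8, 5, 15, 2, 6, 7, 10, 12, 3, 13, 14, 9, 16, 17, 18, 11],
     [4, 3, 8, 5, 15, 2, 6, 7, 1, 9, 10, 16, 12, 13, 14, 17, 18, 11],
     [4, 1, 8, 5, 6, 2, 17, 7, 10, 11, 3, 16, 12, 9, 14, 15, 18, 13],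
     [4, 1, 2, 8, 15, 5, 6, 3, 10, 11, 18, 16, 12, 9, 14, 17, 7, 13],
     [9, 1, 2, 5, 6, 7, 8, 4, 10, 12, 3, 13, 14, 15, 16, 17, 18, 11],
     [4, 3, 8, 5, 6, 2, 17, 7, 1, 12, 10, 13, 18, 9, 14, 15, 16, 11],
     [9, 1, 8, 5, 15, 2, 6, 4, 10, 12, 3, 16, 18, 13, 14, 17, 7, 11],
     [4, 3, 11, 8, 6, 2, 17, 7, 1, 9, 18, 10, 14, 15, 5, 12, 16, 13],
     [4, 1, 2, 8, 15, 5, 6, 7, 10, 11, 3, 13, 18, 9, 14, 12, 16, 17]]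
    [((2, 6), (4, 8), 2, 3,
       [2, 4, 8, 1, 15, 5, 6, 7, 10, 12, 3, 13, 14, 9, 16, 17, 18, 11]),
     ((2, 6), (12, 13), 2, 5,
       [4, 12, 2, 8, 15, 5, 6, 7, 1, 11, 3, 10, 14, 9, 16, 17, 18, 13]),
     ((4, 8), (12, 13), 4, 5,
       [4, 3, 8, 13, 6, 2, 17, 7, 1, 12, 10, 16, 14, 9, 5, 15, 18, 11])]
    (by decide +kernel) (by decide +kernel) (by decide +kernel)

theorem not_hasGadgetPair_P26 : ¬ HasGadgetPair P26 :=
  not_hasGadgetPair_labelledGraph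
    [[7, 1, 13, 5, 2, 25, 12, 9, 4, 8, 16, 11, 14, 10, 6, 15, 3, 17, 18, 24, 20, 21, 22, 23, 26,
      19],
     [7, 1, 2, 23, 4, 5, 12, 10, 8, 11, 16, 13, 14, 15, 6, 9, 3, 17, 18, 24, 20, 21, 22, 25, 26,
      19],
     [7, 1, 2, 5, 6, 25, 12, 9, 4, 8, 10, 13, 14, 15, 16, 11, 3, 19, 26, 18, 20, 17, 22, 23, 24,
      21],
     [7, 1, 2, 23, 4, 5, 8, 9, 16, 11, 12, 13, 14, 10, 6, 15, 3, 20, 18, 21, 22, 17, 24, 25, 26,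
      19],
     [7, 5, 2, 23, 4, 25, 12, 10, 8, 11, 16, 13, 14, 15, 6, 9, 3, 19, 1, 18, 22, 17, 24, 20, 26,
      21],
     [19, 1, 2, 5, 6, 15, 12, 7, 8, 14, 10, 11, 3, 13, 16, 9, 22, 17, 18, 24, 20, 23, 4, 25, 26,
      21],
     [7, 3, 13, 5, 2, 25, 8, 10, 4, 14, 16, 11, 12, 15, 6, 9, 18, 20, 1, 21, 26, 17, 22, 23, 24,
      19],
     [7, 3, 13, 23, 2, 5, 8, 10, 4, 14, 16, 11, 12, 15, 6, 9, 18, 20, 1, 21, 22, 17, 24, 25, 26,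
      19],
     [19, 1, 17, 9, 2, 5, 8, 10, 16, 11, 12, 7, 3, 13, 14, 15, 22, 20, 18, 24, 26, 21, 4, 23, 6,
      25],
     [7, 3, 13, 5, 2, 25, 12, 9, 4, 8, 16, 11, 14, 10, 6, 15, 18, 19, 1, 24, 20, 17, 22, 23, 26,
      21]]
    [((2, 5), (10, 11), 2, 5,
       [7, 11, 2, 5, 6, 25, 8, 10, 4, 14, 12, 13, 3, 15, 16, 9, 18, 19, 1, 24, 20, 17, 22, 23,
        26, 21]),
     ((2, 5), (20, 21), 2, 5,
       [7, 20, 2, 5, 6, 25, 8, 10, 4, 11, 12, 13, 14, 15, 16, 9, 3, 17, 1, 18, 26, 21, 22, 23,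
        24, 19]),
     ((10, 11), (20, 21), 10, 7,
       [7, 3, 17, 9, 2, 5, 8, 10, 16, 20, 12, 13, 14, 15, 6, 11, 22, 19, 1, 18, 26, 21, 4, 23,
        24, 25])]
    (by decide +kernel) (by decide +kernel) (by decide +kernel)

theorem not_hasGadgetPair_P34 : ¬ HasGadgetPair P34 :=
  not_hasGadgetPair_labelledGraph
    [[17, 33, 13, 11, 1, 5, 2, 6, 14, 9, 10, 8, 12, 7, 4, 15, 24, 16, 18, 19, 20, 21, 22, 23,
      26, 27, 3, 29, 30, 31, 32, 28, 34, 25],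
     [25, 7, 13, 15, 1, 8, 6, 12, 10, 5, 4, 11, 14, 9, 16, 17, 24, 22, 18, 19, 20, 21, 3, 23,
      26, 27, 30, 29, 34, 31, 32, 28, 2, 33],
     [25, 33, 13, 15, 1, 7, 14, 6, 8, 5, 10, 11, 12, 9, 20, 17, 24, 16, 18, 19, 2, 21, 22, 23,
      26, 28, 3, 32, 30, 27, 4, 31, 34, 29],
     [17, 7, 13, 31, 1, 8, 6, 12, 10, 5, 4, 11, 14, 9, 20, 15, 16, 22, 18, 21, 2, 23, 24, 19,
      26, 28, 3, 29, 30, 27, 32, 33, 34, 25],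
     [17, 33, 13, 15, 1, 5, 6, 12, 8, 9, 10, 11, 14, 7, 20, 18, 16, 22, 24, 19, 2, 21, 3, 23,
      26, 27, 30, 32, 28, 29, 4, 31, 34, 25],
     [25, 21, 13, 15, 6, 8, 2, 9, 14, 5, 10, 11, 12, 7, 20, 17, 1, 16, 24, 19, 22, 18, 3, 23,
      34, 27, 30, 26, 28, 29, 4, 31, 32, 33],
     [25, 21, 27, 11, 1, 5, 6, 12, 8, 9, 10, 13, 14, 7, 16, 17, 24, 19, 20, 15, 22, 18, 3, 23,
      26, 28, 30, 32, 34, 29, 4, 31, 2, 33],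
     [25, 21, 27, 11, 6, 7, 14, 9, 10, 5, 12, 8, 3, 13, 16, 17, 1, 22, 18, 15, 20, 23, 24, 19,
      34, 28, 26, 32, 30, 31, 4, 33, 2, 29]]
    [((8, 9), (18, 19), 8, 7,
       [25, 7, 23, 11, 10, 5, 6, 18, 14, 9, 12, 8, 3, 13, 4, 15, 1, 16, 24, 19, 20, 21, 22, 17,
        34, 27, 30, 26, 28, 31, 32, 33, 2, 29]),
     ((8, 9), (28, 29), 8, 7,
       [25, 7, 23, 11, 10, 5, 6, 28, 14, 9, 12, 8, 3, 13, 16, 17, 1, 22, 18, 15, 20, 21, 24, 19,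
        26, 27, 30, 32, 34, 29, 4, 31, 2, 33]),
     ((18, 19), (28, 29), 18, 7,
       [17, 21, 13, 31, 6, 7, 2, 12, 8, 5, 10, 11, 14, 9, 4, 18, 16, 28, 20, 15, 22, 23, 24, 19,
        1, 25, 3, 26, 30, 27, 32, 33, 34, 29])]
    (by decide +kernel) (by decide +kernel) (by decide +kernel)

/-! ### Claws arranged in a ring -/

section Ring

variable {ι : Type*}

/-- The edges of a cyclic arrangement of claws along the permutation `σ`: the claw at `i` has hub
`inl i` and ends `inr (i, s)`, and the end `s` at `i` is linked to the end `π i s` at `σ i`. Only the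
spokes in `spk` and the links in `lnk` are kept. -/
inductive RingEdge (σ : Equiv.Perm ι) (π : ι → Equiv.Perm (Fin 3)) (spk lnk : ι → Fin 3 → Prop) :
    ι ⊕ ι × Fin 3 → ι ⊕ ι × Fin 3 → Prop
  | spoke (i : ι) (s : Fin 3) : spk i s → RingEdge σ π spk lnk (.inl i) (.inr (i, s))
  | link (i : ι) (s : Fin 3) : lnk i s → RingEdge σ π spk lnk (.inr (i, s)) (.inr (σ i, π i s))

/-- The graph with the edges `RingEdge`. -/
def ringSubgraph (σ : Equiv.Perm ι) (π : ι → Equiv.Perm (Fin 3)) (spk lnk : ι → Fin 3 → Prop) :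
    SimpleGraph (ι ⊕ ι × Fin 3) :=
  SimpleGraph.fromRel (RingEdge σ π spk lnk)

/-- The cyclic arrangement of claws with all spokes and links. -/
def ringGraph (σ : Equiv.Perm ι) (π : ι → Equiv.Perm (Fin 3)) : SimpleGraph (ι ⊕ ι × Fin 3) :=
  ringSubgraph σ π (fun _ _ => True) (fun _ _ => True)

variable {σ : Equiv.Perm ι} {π : ι → Equiv.Perm (Fin 3)} {spk lnk : ι → Fin 3 → Prop}

theorem ringSubgraph_le : ringSubgraph σ π spk lnk ≤ ringGraph σ π := by
  have hmono {x y} (h : RingEdge σ π spk lnk x y) :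
      RingEdge σ π (fun _ _ => True) (fun _ _ => True) x y := by
    cases h with
    | spoke i s => exact .spoke i s trivial
    | link i s => exact .link i s trivial
  rintro x y h
  rw [ringSubgraph, SimpleGraph.fromRel_adj] at h
  rw [ringGraph, ringSubgraph, SimpleGraph.fromRel_adj]
  exact ⟨h.1, h.2.imp hmono hmono⟩

@[simp]
theorem ringSubgraph_adj_hub_hub {i j : ι} :
    ¬ (ringSubgraph σ π spk lnk).Adj (.inl i) (.inl j) := by
  rw [ringSubgraph, SimpleGraph.fromRel_adj]
  rintro ⟨-, h | h⟩ <;> cases h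

@[simp]
theorem ringSubgraph_adj_hub_strand {i j : ι} {s : Fin 3} :
    (ringSubgraph σ π spk lnk).Adj (.inl i) (.inr (j, s)) ↔ j = i ∧ spk i s := by
  rw [ringSubgraph, SimpleGraph.fromRel_adj]
  constructor
  · rintro ⟨-, h | h⟩ <;> cases h
    exact ⟨rfl, ‹_›⟩
  · rintro ⟨rfl, h⟩
    exact ⟨Sum.inl_ne_inr, .inl (.spoke _ _ h)⟩

@[simp]
theorem ringSubgraph_adj_strand_hub {i j : ι} {s : Fin 3} :
    (ringSubgraph σ π spk lnk).Adj (.inr (j, s)) (.inl i) ↔ j = i ∧ spk i s := by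
  rw [SimpleGraph.adj_comm, ringSubgraph_adj_hub_strand]

theorem ringSubgraph_adj_strand_strand (hσ : ∀ i, σ i ≠ i) {i j : ι} {s u : Fin 3} :
    (ringSubgraph σ π spk lnk).Adj (.inr (i, s)) (.inr (j, u)) ↔
      (j = σ i ∧ u = π i s ∧ lnk i s) ∨ (i = σ j ∧ s = π j u ∧ lnk j u) := by
  rw [ringSubgraph, SimpleGraph.fromRel_adj]
  constructor
  · rintro ⟨-, h | h⟩ <;> cases h
    · exact .inl ⟨rfl, rfl, ‹_›⟩
    · exact .inr ⟨rfl, rfl, ‹_›⟩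
  · rintro (⟨rfl, rfl, h⟩ | ⟨rfl, rfl, h⟩)
    · exact ⟨fun h' => hσ i (congrArg Prod.fst (Sum.inr.inj h')).symm, .inl (.link _ _ h)⟩
    · exact ⟨fun h' => hσ j (congrArg Prod.fst (Sum.inr.inj h')), .inr (.link _ _ h)⟩

theorem ncard_neighborSet_hub {i : ι} {r : Fin 3} (h : ∀ s, spk i s ↔ s ≠ r) :
    ((ringSubgraph σ π spk lnk).neighborSet (.inl i)).ncard = 2 := by
  obtain ⟨p, q, hpq, hr⟩ : ∃ p q : Fin 3, p ≠ q ∧ ∀ s, s ≠ r ↔ s = p ∨ s = q := by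
    clear h; revert r; decide
  rw [Set.ncard_eq_two]
  refine ⟨.inr (i, p), .inr (i, q), fun h' => hpq (congrArg Prod.snd (Sum.inr.inj h')), ?_⟩
  ext (j | ⟨j, s⟩)
  · simp
  · simp only [SimpleGraph.mem_neighborSet, ringSubgraph_adj_hub_strand, h, hr,
      Set.mem_insert_iff, Set.mem_singleton_iff, Sum.inr.injEq, Prod.mk.injEq]
    tauto

/-- The neighbours of an end of a claw: its hub, and the ends linked to it on the right and on the
left. -/
theorem neighborSet_strand (hσ : ∀ i, σ i ≠ i) (i : ι) (s : Fin 3) :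
    (ringSubgraph σ π spk lnk).neighborSet (.inr (i, s)) =
      {x | x = .inl i ∧ spk i s} ∪ {x | x = .inr (σ i, π i s) ∧ lnk i s} ∪
        {x | x = .inr (σ.symm i, (π (σ.symm i)).symm s) ∧
          lnk (σ.symm i) ((π (σ.symm i)).symm s)} := by
  ext (j | ⟨j, u⟩)
  · simp only [SimpleGraph.mem_neighborSet, ringSubgraph_adj_strand_hub, Set.mem_union,
      Set.mem_ofPred_eq, Sum.inl.injEq, reduceCtorEq, false_and, or_false]
    constructor <;> (rintro ⟨rfl, h⟩; exact ⟨rfl, h⟩)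
  · simp only [SimpleGraph.mem_neighborSet, ringSubgraph_adj_strand_strand hσ, Set.mem_union,
      Set.mem_ofPred_eq, Sum.inr.injEq, Prod.mk.injEq, reduceCtorEq, false_and, false_or, and_assoc]
    refine or_congr Iff.rfl ?_
    constructor
    · rintro ⟨rfl, rfl, h⟩
      simpa using h
    · rintro ⟨rfl, rfl, h⟩
      simpa using h

theorem ncard_neighborSet_strand (hσ : ∀ i, σ i ≠ i) (hσ2 : ∀ i, σ (σ i) ≠ i) {i : ι} {s : Fin 3}
    (h : (spk i s ∧ lnk i s ∧ ¬ lnk (σ.symm i) ((π (σ.symm i)).symm s)) ∨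
      (spk i s ∧ ¬ lnk i s ∧ lnk (σ.symm i) ((π (σ.symm i)).symm s)) ∨
      (¬ spk i s ∧ lnk i s ∧ lnk (σ.symm i) ((π (σ.symm i)).symm s))) :
    ((ringSubgraph σ π spk lnk).neighborSet (.inr (i, s))).ncard = 2 := by
  rw [neighborSet_strand hσ]
  rcases h with ⟨h1, h2, h3⟩ | ⟨h1, h2, h3⟩ | ⟨h1, h2, h3⟩
  · rw [Set.ncard_eq_two]
    exact ⟨_, _, Sum.inl_ne_inr, by
      simp only [h1, h2, h3, and_true, and_false, Set.ofPred_false, Set.union_empty]; rfl⟩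
  · rw [Set.ncard_eq_two]
    exact ⟨_, _, Sum.inl_ne_inr, by
      simp only [h1, h2, h3, and_true, and_false, Set.ofPred_false, Set.union_empty]; rfl⟩
  · rw [Set.ncard_eq_two]
    refine ⟨.inr (σ i, π i s), .inr (σ.symm i, (π (σ.symm i)).symm s), fun h' => ?_, by
      simp only [h1, h2, h3, and_true, and_false, Set.ofPred_false, Set.empty_union]; rfl⟩
    have := congrArg Prod.fst (Sum.inr.inj h')
    exact hσ2 i ((Equiv.eq_symm_apply σ).1 this)

/-! ### Perfect matchings with one link in every gap -/

section Matching

/-- The 2-factor left by a perfect matching with one link `x i` in every gap. -/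
theorem isTwoFactor_ringSubgraph (hσ : ∀ i, σ i ≠ i) (hσ2 : ∀ i, σ (σ i) ≠ i) {x : ι → Fin 3}
    (hx : ∀ i, π i (x i) ≠ x (σ i)) :
    IsTwoFactor (ringGraph σ π) (ringSubgraph σ π
      (fun i s => s = x i ∨ s = π (σ.symm i) (x (σ.symm i))) (fun i s => s ≠ x i)) := by
  have hx' (i : ι) : π (σ.symm i) (x (σ.symm i)) ≠ x i := by simpa using hx (σ.symm i)
  refine ⟨ringSubgraph_le, ?_⟩
  rintro (i | ⟨i, s⟩)
  · obtain ⟨r, hr⟩ : ∃ r : Fin 3, ∀ s, s = x i ∨ s = π (σ.symm i) (x (σ.symm i)) ↔ s ≠ r := by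
      have := hx' i
      generalize π (σ.symm i) (x (σ.symm i)) = y at *
      generalize x i = z at *
      revert y z; decide
    exact ncard_neighborSet_hub hr
  · apply ncard_neighborSet_strand hσ hσ2
    have := hx' i
    simp only [ne_eq, Equiv.symm_apply_eq]
    -- The matching covers an end by its link to the right, its link to the left or its spoke; the
    -- other two edges remain.
    by_cases h1 : s = x i
    · subst h1
      simp [Ne.symm this]
    · by_cases h2 : s = π (σ.symm i) (x (σ.symm i)) <;> simp [h1, h2, this]

/-- `x` is proper on `S`: links of a gap in `S` and the next gap in `S` have no common end. -/
def ProperOn (σ : Equiv.Perm ι) (π : ι → Equiv.Perm (Fin 3)) (S : Set ι) (x : ι → Fin 3) : Prop :=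
  ∀ i ∈ S, σ i ∈ S → π i (x i) ≠ x (σ i)

theorem ProperOn.insert_update [DecidableEq ι] (hσ : ∀ i, σ i ≠ i) {S : Set ι} {x : ι → Fin 3}
    (h : ProperOn σ π S x) {k : ι} (hk : k ∉ S) {c : Fin 3} (hr : σ k ∈ S → π k c ≠ x (σ k))
    (hl : σ.symm k ∈ S → π (σ.symm k) (x (σ.symm k)) ≠ c) :
    ProperOn σ π (insert k S) (Function.update x k c) := by
  have hne {i : ι} (hi : i ∈ S) : i ≠ k := by rintro rfl; exact hk hi
  rintro i (rfl | hi) (hi' | hi')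
  · exact absurd hi' (hσ _)
  · rw [Function.update_self, Function.update_of_ne (hne hi')]
    exact hr hi'
  · subst hi'
    rw [Function.update_self, Function.update_of_ne (hne hi)]
    simpa using hl (by simpa using hi)
  · rw [Function.update_of_ne (hne hi), Function.update_of_ne (hne hi')]
    exact h i hi hi'

/-- The two neighbouring gaps exclude at most two of the three strands. -/
theorem ProperOn.exists_insert (hσ : ∀ i, σ i ≠ i) {S : Set ι} {x : ι → Fin 3}
    (h : ProperOn σ π S x) (k : ι) :
    ∃ y, ProperOn σ π (insert k S) y ∧ ∀ i ∈ S, y i = x i := by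
  classical
  by_cases hk : k ∈ S
  · exact ⟨x, by rwa [Set.insert_eq_of_mem hk], fun _ _ => rfl⟩
  obtain ⟨c, h1, h2⟩ : ∃ c : Fin 3, c ≠ (π k).symm (x (σ k)) ∧
      c ≠ π (σ.symm k) (x (σ.symm k)) := by
    generalize (π k).symm (x (σ k)) = y
    generalize π (σ.symm k) (x (σ.symm k)) = z
    clear h; revert y z; decide
  exact ⟨_, h.insert_update hσ hk (fun _ h => h1 ((Equiv.eq_symm_apply _).2 h)) (fun _ => h2.symm),
    fun i hi => Function.update_of_ne (by rintro rfl; exact hk hi) ..⟩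

/-- A gap with at most one neighbour in `S` can be given a strand different from `b`. -/
theorem ProperOn.exists_insert_ne (hσ : ∀ i, σ i ≠ i) {S : Set ι} {x : ι → Fin 3}
    (h : ProperOn σ π S x) (k : ι) (b : Fin 3) (hS : k ∉ S → σ k ∉ S ∨ σ.symm k ∉ S)
    (hb : k ∈ S → x k ≠ b) :
    ∃ y, ProperOn σ π (insert k S) y ∧ y k ≠ b ∧ ∀ i ∈ S, y i = x i := by
  classical
  by_cases hk : k ∈ S
  · exact ⟨x, by rwa [Set.insert_eq_of_mem hk], hb hk, fun _ _ => rfl⟩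
  have hfin : ∀ z : Fin 3, ∃ c, c ≠ z ∧ c ≠ b := by clear hb; revert b; decide
  obtain ⟨c, hcb, hr, hl⟩ : ∃ c, c ≠ b ∧ (σ k ∈ S → π k c ≠ x (σ k)) ∧
      (σ.symm k ∈ S → π (σ.symm k) (x (σ.symm k)) ≠ c) := by
    rcases hS hk with hS | hS
    · obtain ⟨c, hc, hcb⟩ := hfin (π (σ.symm k) (x (σ.symm k)))
      exact ⟨c, hcb, fun h => absurd h hS, fun _ => hc.symm⟩
    · obtain ⟨c, hc, hcb⟩ := hfin ((π k).symm (x (σ k)))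
      exact ⟨c, hcb, fun _ h => hc ((Equiv.eq_symm_apply _).2 h), fun h => absurd h hS⟩
  exact ⟨_, h.insert_update hσ hk hr hl, by rwa [Function.update_self],
    fun i hi => Function.update_of_ne (by rintro rfl; exact hk hi) ..⟩

theorem properOn_empty (x : ι → Fin 3) : ProperOn σ π ∅ x := fun _ h => h.elim

theorem properOn_singleton (hσ : ∀ i, σ i ≠ i) (i : ι) (x : ι → Fin 3) : ProperOn σ π {i} x := by
  rintro _ rfl h
  exact absurd h (hσ _)

theorem ProperOn.exists_extension [Finite ι] (hσ : ∀ i, σ i ≠ i) {S : Set ι} {x : ι → Fin 3}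
    (h : ProperOn σ π S x) : ∃ y : ι → Fin 3, (∀ i, π i (y i) ≠ y (σ i)) ∧ ∀ i ∈ S, y i = x i := by
  obtain ⟨y, hy, hyx⟩ : ∃ y, ProperOn σ π (Set.univ ∪ S) y ∧ ∀ i ∈ S, y i = x i := by
    refine Set.Finite.induction_on (motive := fun T _ => ∃ y, ProperOn σ π (T ∪ S) y ∧
      ∀ i ∈ S, y i = x i) _ Set.finite_univ ⟨x, by rwa [Set.empty_union], fun _ _ => rfl⟩ ?_
    rintro k T - - ⟨y, hy, hyx⟩
    obtain ⟨z, hz, hzy⟩ := hy.exists_insert hσ k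
    exact ⟨z, by rwa [Set.insert_union], fun i hi => (hzy i (.inr hi)).trans (hyx i hi)⟩
  exact ⟨y, fun i => hy i (.inl trivial) (.inl trivial), hyx⟩

/-- A perfect matching, given by its links `x`, through two given links. -/
theorem exists_proper_link_link [Finite ι] (hσ : ∀ i, σ i ≠ i) {i j : ι} {p q : Fin 3}
    (hij : i ≠ j) (h1 : j = σ i → π i p ≠ q) (h2 : i = σ j → π j q ≠ p) :
    ∃ x : ι → Fin 3, (∀ k, π k (x k) ≠ x (σ k)) ∧ x i = p ∧ x j = q := by
  classical
  have h := (properOn_singleton (π := π) hσ i (fun _ => p)).insert_update hσ (k := j) (c := q)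
    hij.symm (fun h => h2 h.symm) (fun h => by
      rw [show σ.symm j = i from h]
      exact h1 ((Equiv.symm_apply_eq σ).1 h))
  obtain ⟨x, hx, hxS⟩ := h.exists_extension hσ
  refine ⟨x, hx, ?_, ?_⟩
  · rw [hxS i (by simp), Function.update_of_ne hij]
  · rw [hxS j (by simp), Function.update_self]

/-- A perfect matching, given by its links `x`, through a given spoke and a given link. -/
theorem exists_proper_spoke_link [Finite ι] (hσ : ∀ i, σ i ≠ i) (hσ2 : ∀ i, σ (σ i) ≠ i)
    (hσ3 : ∀ i, σ (σ (σ i)) ≠ i) {i j : ι} {s q : Fin 3} (h1 : j = i → q ≠ s)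
    (h2 : i = σ j → π j q ≠ s) :
    ∃ x : ι → Fin 3, (∀ k, π k (x k) ≠ x (σ k)) ∧ x i ≠ s ∧
      π (σ.symm i) (x (σ.symm i)) ≠ s ∧ x j = q := by
  have h0 := properOn_singleton (π := π) hσ j (fun _ => q)
  have hsymm {k l : ι} : σ.symm k = l ↔ k = σ l := Equiv.symm_apply_eq σ
  have hq {y : ι → Fin 3} (hy : y j = q) (h : σ.symm i = j) :
      y (σ.symm i) ≠ (π (σ.symm i)).symm s := by
    rw [Ne, Equiv.eq_symm_apply, h, hy]
    exact h2 (hsymm.1 h)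
  -- The spoke restricts the gaps on both sides of claw `i`, and each must be filled while at most
  -- one of its neighbours is fixed. If `i` is two steps after `j`, the gap before claw `i` adjoins
  -- gap `j` and has to come first; otherwise it can come last.
  by_cases hij : i = σ (σ j)
  · obtain ⟨y, hy, hyb, hyS⟩ := h0.exists_insert_ne hσ (σ.symm i) ((π (σ.symm i)).symm s)
      (fun _ => .inl fun h => by
        rw [Equiv.apply_symm_apply] at h
        exact hσ2 j (hij.symm.trans h))
      (fun h => hq (y := fun _ => q) rfl h)
    obtain ⟨z, hz, hzb, hzS⟩ := hy.exists_insert_ne hσ i s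
      (fun _ => .inl fun h => by
        rcases h with h | h
        · exact hσ2 i (hsymm.1 h.symm).symm
        · exact hσ3 j (by rw [← hij]; exact h))
      (fun h => by
        rcases h with h | h
        · exact absurd (hsymm.1 h.symm).symm (hσ i)
        · exact absurd (hij.symm.trans h) (hσ2 j))
    obtain ⟨x, hx, hxS⟩ := hz.exists_extension hσ
    refine ⟨x, hx, ?_, ?_, ?_⟩
    · rwa [hxS i (by simp)]
    · rw [hxS _ (by simp), hzS _ (by simp)]
      exact fun h => hyb ((Equiv.eq_symm_apply _).2 h)
    · rw [hxS j (by simp), hzS j (by simp), hyS j (by simp)]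
  · obtain ⟨y, hy, hyb, hyS⟩ := h0.exists_insert_ne hσ i s
      (fun _ => by
        by_contra! h
        exact hσ2 i (by rw [show σ i = j from h.1]; exact (hsymm.1 h.2).symm))
      (fun h => h1 (Eq.symm h))
    have hyj : y j = q := hyS j (by simp)
    obtain ⟨z, hz, hzb, hzS⟩ := hy.exists_insert_ne hσ (σ.symm i) ((π (σ.symm i)).symm s)
      (fun _ => .inr fun h => by
        rcases h with h | h
        · exact hσ2 i (hsymm.1 (hsymm.1 h)).symm
        · exact hij (hsymm.1 (hsymm.1 h)))
      (fun h => by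
        rcases h with h | h
        · exact absurd (hsymm.1 h).symm (hσ i)
        · exact hq hyj h)
    obtain ⟨x, hx, hxS⟩ := hz.exists_extension hσ
    refine ⟨x, hx, ?_, ?_, ?_⟩
    · rwa [hxS i (by simp), hzS i (by simp)]
    · rw [hxS _ (by simp)]
      exact fun h => hzb ((Equiv.eq_symm_apply _).2 h)
    · rw [hxS j (by simp), hzS j (by simp), hyj]

/-- The four gaps beside the two claws are distinct and are filled from left to right, those of `i`
before those of `j`. The hypothesis `h3` keeps the gap after claw `j` from adjoining one already
filled on its right. -/
theorem exists_proper_spoke_spoke_of_far [Finite ι] (hσ : ∀ i, σ i ≠ i) (hσ2 : ∀ i, σ (σ i) ≠ i)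
    {i j : ι} (s u : Fin 3) (hij : i ≠ j) (h1 : j ≠ σ i) (h2 : i ≠ σ j) (h3 : i ≠ σ (σ j)) :
    ∃ x : ι → Fin 3, (∀ k, π k (x k) ≠ x (σ k)) ∧
      (x i ≠ s ∧ π (σ.symm i) (x (σ.symm i)) ≠ s) ∧
      (x j ≠ u ∧ π (σ.symm j) (x (σ.symm j)) ≠ u) := by
  have hsymm {k l : ι} : σ.symm k = l ↔ k = σ l := Equiv.symm_apply_eq σ
  have hsymm' {k l : ι} : l = σ.symm k ↔ k = σ l := by rw [eq_comm, hsymm]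
  obtain ⟨y, hy, hyb, -⟩ := (properOn_empty (σ := σ) (π := π) 0).exists_insert_ne hσ (σ.symm i)
    ((π (σ.symm i)).symm s) (fun _ => .inl id) (fun h => h.elim)
  obtain ⟨z, hz, hzb, hzS⟩ := hy.exists_insert_ne hσ i s
    (fun _ => .inl (by simp [hsymm', (hσ2 i).symm])) (by simp [hsymm', (hσ i).symm])
  obtain ⟨w, hw, hwb, hwS⟩ := hz.exists_insert_ne hσ (σ.symm j) ((π (σ.symm j)).symm u)
    (fun _ => .inl (by simp [hsymm', h2, hij.symm])) (by simp [hsymm, hij.symm, h1])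
  obtain ⟨v, hv, hvb, hvS⟩ := hw.exists_insert_ne hσ j u
    (fun _ => .inl (by simp [hsymm', h2.symm, h3, (hσ2 j).symm]))
    (by simp [hsymm', (hσ j).symm, hij.symm, h2])
  obtain ⟨x, hx, hxS⟩ := hv.exists_extension hσ
  refine ⟨x, hx, ⟨?_, ?_⟩, ?_, ?_⟩
  · rwa [hxS i (by simp), hvS i (by simp), hwS i (by simp)]
  · rw [hxS _ (by simp), hvS _ (by simp), hwS _ (by simp), hzS _ (by simp)]
    exact fun h => hyb ((Equiv.eq_symm_apply _).2 h)
  · rwa [hxS j (by simp)]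
  · rw [hxS _ (by simp), hvS _ (by simp)]
    exact fun h => hwb ((Equiv.eq_symm_apply _).2 h)

/-- The gap between the two claws is restricted by both spokes, which still leaves one strand `c`;
it is fixed first, then the outer gaps on either side. -/
theorem exists_proper_spoke_spoke_of_next [Finite ι] (hσ : ∀ i, σ i ≠ i)
    (hσ2 : ∀ i, σ (σ i) ≠ i) (hσ3 : ∀ i, σ (σ (σ i)) ≠ i) (i : ι) (s u : Fin 3) :
    ∃ x : ι → Fin 3, (∀ k, π k (x k) ≠ x (σ k)) ∧
      (x i ≠ s ∧ π (σ.symm i) (x (σ.symm i)) ≠ s) ∧ (x (σ i) ≠ u ∧ π i (x i) ≠ u) := by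
  have hsymm' {k l : ι} : l = σ.symm k ↔ k = σ l := by rw [eq_comm, Equiv.symm_apply_eq]
  obtain ⟨c, hcs, hcu⟩ : ∃ c : Fin 3, c ≠ s ∧ c ≠ (π i).symm u := by
    generalize (π i).symm u = z
    revert s z; decide
  obtain ⟨y, hy, hyb, hyS⟩ := (properOn_singleton (π := π) hσ i (fun _ => c)).exists_insert_ne hσ
    (σ.symm i) ((π (σ.symm i)).symm s)
    (fun _ => .inr (by simp [Equiv.symm_apply_eq, (hσ2 i).symm]))
    (by simp [Equiv.symm_apply_eq, (hσ i).symm])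
  obtain ⟨z, hz, hzb, hzS⟩ := hy.exists_insert_ne hσ (σ i) u
    (fun _ => .inl (by simp [hsymm', (hσ3 i).symm, hσ2 i]))
    (by simp [hsymm', (hσ2 i).symm, hσ i])
  obtain ⟨x, hx, hxS⟩ := hz.exists_extension hσ
  have hxi : x i = c := by rw [hxS i (by simp), hzS i (by simp), hyS i (by simp)]
  refine ⟨x, hx, ⟨by rwa [hxi], ?_⟩, ?_, ?_⟩
  · rw [hxS _ (by simp), hzS _ (by simp)]
    exact fun h => hyb ((Equiv.eq_symm_apply _).2 h)
  · rwa [hxS _ (by simp)]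
  · rw [hxi]
    exact fun h => hcu ((Equiv.eq_symm_apply _).2 h)

/-- A perfect matching, given by its links `x`, through two given spokes. -/
theorem exists_proper_spoke_spoke [Finite ι] (hσ : ∀ i, σ i ≠ i) (hσ2 : ∀ i, σ (σ i) ≠ i)
    (hσ3 : ∀ i, σ (σ (σ i)) ≠ i) (hσ4 : ∀ i, σ (σ (σ (σ i))) ≠ i) {i j : ι} (s u : Fin 3)
    (hij : i ≠ j) :
    ∃ x : ι → Fin 3, (∀ k, π k (x k) ≠ x (σ k)) ∧
      (x i ≠ s ∧ π (σ.symm i) (x (σ.symm i)) ≠ s) ∧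
      (x j ≠ u ∧ π (σ.symm j) (x (σ.symm j)) ≠ u) := by
  by_cases h1 : j = σ i
  · subst h1
    simpa using exists_proper_spoke_spoke_of_next (π := π) hσ hσ2 hσ3 i s u
  by_cases h2 : i = σ j
  · subst h2
    obtain ⟨x, hx, h, h'⟩ := exists_proper_spoke_spoke_of_next (π := π) hσ hσ2 hσ3 j u s
    exact ⟨x, hx, by simpa using h', h⟩
  -- With `i` two steps after `j` the roles are exchanged; `hσ4` prevents `j` from also being two
  -- steps after `i`.
  by_cases h3 : i = σ (σ j)
  · obtain ⟨x, hx, h, h'⟩ := exists_proper_spoke_spoke_of_far (π := π) hσ hσ2 u s hij.symm h2 h1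
      (fun h => hσ4 j (by rw [← h3]; exact h.symm))
    exact ⟨x, hx, h', h⟩
  · exact exists_proper_spoke_spoke_of_far hσ hσ2 s u hij h1 h2 h3

end Matching

end Ring

/-! ### Invariance under isomorphism -/

section Transport

variable {V V' : Type*} {R : SimpleGraph V} {R' : SimpleGraph V'}

theorem IsTwoFactor.comap (φ : R ≃g R') {F : SimpleGraph V'} (h : IsTwoFactor R' F) :
    IsTwoFactor R (F.comap φ) := by
  refine ⟨fun v w hvw => φ.map_adj_iff.1 (h.1 hvw), fun v => ?_⟩
  have : (F.comap φ).neighborSet v = φ.symm '' F.neighborSet (φ v) := by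
    ext w
    simp only [SimpleGraph.mem_neighborSet, SimpleGraph.comap_adj, Set.mem_image]
    exact ⟨fun h => ⟨_, h, φ.symm_apply_apply w⟩, by rintro ⟨x, hx, rfl⟩; simpa using hx⟩
  rw [this, Set.ncard_image_of_injective _ φ.symm.injective, h.2]

theorem map_mem_edgeSet_comap (φ : V → V') (F : SimpleGraph V') (e : Sym2 V) :
    e ∈ (F.comap φ).edgeSet ↔ e.map φ ∈ F.edgeSet := by
  induction e with | _ v w => rfl

theorem map_mem_crossEdges {φ : V → V'} (hφ : Function.Injective φ) {a b c d : V} (e : Sym2 V) :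
    e.map φ ∈ crossEdges (φ a) (φ b) (φ c) (φ d) ↔ e ∈ crossEdges a b c d := by
  simp only [crossEdges, Set.mem_insert_iff, Set.mem_singleton_iff, ← Sym2.map_mk,
    (Sym2.map.injective hφ).eq_iff]

/-- An isomorphism of graphs induces one of the graphs obtained by exchanging two edges. -/
def exchangeIso (φ : R ≃g R') (a b c d : V) :
    exchange R a b c d ≃g exchange R' (φ a) (φ b) (φ c) (φ d) where
  toEquiv := φ.toEquiv
  map_rel_iff' {v w} := by
    have hs (x y z t : V) : s(φ x, φ y) = s(φ z, φ t) ↔ s(x, y) = s(z, t) := by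
      rw [← Sym2.map_mk, ← Sym2.map_mk, (Sym2.map.injective φ.injective).eq_iff]
    change (exchange R' _ _ _ _).Adj (φ v) (φ w) ↔ _
    simp only [exchange_adj, hs, φ.map_adj_iff, ne_eq, φ.injective.eq_iff]

theorem exists_isCycle_comap (φ : V ≃ V') {F : SimpleGraph V'} {v : V'} {p : F.Walk v v}
    (hp : p.IsCycle) : ∃ (u : V) (q : (F.comap φ).Walk u u), q.IsCycle ∧ q.length = p.length ∧
      ∀ e, e ∈ q.edges ↔ e.map φ ∈ p.edges := by
  let ψ : F.comap φ ≃g F := SimpleGraph.Iso.comap φ F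
  refine ⟨_, p.map ψ.symm.toHom, hp.map ψ.symm.injective, p.length_map _, fun e => ?_⟩
  rw [SimpleGraph.Walk.edges_map, List.mem_map]
  constructor
  · rintro ⟨e, he, rfl⟩
    rw [Sym2.map_map]
    convert he
    rw [show ⇑φ ∘ ⇑ψ.symm.toHom = id from funext ψ.apply_symm_apply, Sym2.map_id, id]
  · intro he
    refine ⟨_, he, ?_⟩
    rw [Sym2.map_map]
    rw [show ⇑ψ.symm.toHom ∘ ⇑φ = id from funext ψ.symm_apply_apply, Sym2.map_id, id]

/-- The conditions quantify over 2-factors, so those of `R'` are pulled back to `R`, together with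
their cycles. -/
theorem IsGadgetPair.map (φ : R ≃g R') {a b c d : V} (h : IsGadgetPair R a b c d) :
    IsGadgetPair R' (φ a) (φ b) (φ c) (φ d) where
  adj_ab := φ.map_adj_iff.2 h.adj_ab
  adj_cd := φ.map_adj_iff.2 h.adj_cd
  independent := by
    simpa only [ne_eq, φ.injective.eq_iff] using h.independent
  not_avoid F hF := h.not_avoid _ (hF.comap φ)
  exactly_one F hF hx v p hp := by
    obtain ⟨u, q, hq, hlen, -⟩ := exists_isCycle_comap φ.toEquiv hp
    rw [← hlen]
    exact h.exactly_one _ (hF.comap φ) hx u q hq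
  both F hF ha hc := by
    obtain ⟨h1, h2⟩ := h.both _ (hF.comap φ) ha hc
    refine ⟨fun v p hp => ?_, fun v p hp hn => ?_⟩
    · obtain ⟨u, q, hq, hlen, -⟩ := exists_isCycle_comap φ.toEquiv hp
      rw [← hlen]
      exact h1 u q hq
    · obtain ⟨u, q, hq, -, he⟩ := exists_isCycle_comap φ.toEquiv hp
      exact h2 u q hq ⟨(he _).2 hn.1, (he _).2 hn.2⟩
  cross F hF e he v p hp := by
    obtain ⟨u, q, hq, hlen, hqe⟩ := exists_isCycle_comap φ.toEquiv hp
    obtain ⟨e, rfl⟩ : ∃ e' : Sym2 V, e'.map φ = e := by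
      induction e with | _ x y =>
      exact ⟨s(φ.symm x, φ.symm y), by simp⟩
    have := h.cross _ (hF.comap (exchangeIso φ a b c d)) e ?_ u q hq
    · rw [← hlen]
      exact ⟨fun h' => this.1 ((hqe e).2 h'), fun h' => this.2 (mt (hqe e).1 h')⟩
    · ext x
      have hx := Set.ext_iff.1 he (x.map φ)
      rw [Set.mem_inter_iff, Set.mem_singleton_iff, map_mem_crossEdges φ.injective,
        (Sym2.map.injective φ.injective).eq_iff] at hx
      rw [Set.mem_inter_iff, Set.mem_singleton_iff, ← hx]
      exact and_congr_left' (map_mem_edgeSet_comap _ F x)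

end Transport

/-! ### Rings of claws have no gadget-pair -/

section RingGadget

variable {ι : Type*} {σ : Equiv.Perm ι} {π : ι → Equiv.Perm (Fin 3)}

/-- The graph in which the gaps in `D` are crossed by the single strand `t` only, and the gaps not
in `D` by all three strands. -/
def singleStrandGraph (σ : Equiv.Perm ι) (π : ι → Equiv.Perm (Fin 3)) (D : Set ι) (t : ι → Fin 3) :
    SimpleGraph (ι ⊕ ι × Fin 3) :=
  ringSubgraph σ π (fun j s => s ≠ t j) (fun j s => j ∈ D → s = t j)

theorem neighborSet_sup_fromEdgeSet {V : Type*} {G : SimpleGraph V} {a c v : V} (ha : v ≠ a)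
    (hc : v ≠ c) : (G ⊔ SimpleGraph.fromEdgeSet {s(a, c)}).neighborSet v = G.neighborSet v := by
  ext w
  simp only [SimpleGraph.mem_neighborSet, SimpleGraph.sup_adj, SimpleGraph.fromEdgeSet_adj,
    Set.mem_singleton_iff, Sym2.eq_iff]
  tauto

theorem neighborSet_sup_fromEdgeSet_self {V : Type*} {G : SimpleGraph V} {a c : V} (hac : a ≠ c) :
    (G ⊔ SimpleGraph.fromEdgeSet {s(a, c)}).neighborSet a = insert c (G.neighborSet a) := by
  ext w
  simp only [SimpleGraph.mem_neighborSet, SimpleGraph.sup_adj, SimpleGraph.fromEdgeSet_adj,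
    Set.mem_singleton_iff, Sym2.eq_iff, Set.mem_insert_iff]
  constructor
  · rintro (h | ⟨⟨-, rfl⟩ | ⟨rfl, -⟩, h⟩)
    · exact .inr h
    · exact .inl rfl
    · exact absurd rfl hac
  · rintro (rfl | h)
    · exact .inr ⟨.inl ⟨trivial, rfl⟩, hac⟩
    · exact .inl h

variable {D : Set ι} {t : ι → Fin 3} {i : ι} {p q : Fin 3}

theorem neighborSet_singleStrandGraph (hσ : ∀ i, σ i ≠ i) (hi : i ∈ D) (hi' : σ.symm i ∈ D)
    (ht : ∀ j ∈ D, t (σ j) = π j (t j)) (hp : p ≠ t i) :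
    (singleStrandGraph σ π D t).neighborSet (.inr (i, p)) = {.inl i} := by
  have h' : (π (σ.symm i)).symm p ≠ t (σ.symm i) := by
    rw [Ne, Equiv.symm_apply_eq, ← ht _ hi', Equiv.apply_symm_apply]
    exact hp
  rw [singleStrandGraph, neighborSet_strand hσ]
  simp only [hi, hi', hp, h', forall_const, and_false, Set.ofPred_false, Set.union_empty, ne_eq,
    not_false_eq_true, and_true]
  rfl

/-- Exactly one of the gaps beside claw `j` is reduced to one strand. The end on strand `t j` keeps
both links and no spoke; the other two keep their spoke and the link in the full gap. -/
theorem ncard_neighborSet_singleStrandGraph (hσ : ∀ i, σ i ≠ i) (hσ2 : ∀ i, σ (σ i) ≠ i) {j : ι}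
    (hj : j ∈ D ↔ σ.symm j ∉ D) (ht : ∀ j ∈ D, t (σ j) = π j (t j)) (s : Fin 3) :
    ((singleStrandGraph σ π D t).neighborSet (.inr (j, s))).ncard = 2 := by
  have ht' (h : σ.symm j ∈ D) : (π (σ.symm j)).symm s = t (σ.symm j) ↔ s = t j := by
    rw [Equiv.symm_apply_eq, ← ht _ h, Equiv.apply_symm_apply]
  apply ncard_neighborSet_strand hσ hσ2
  by_cases hs : s = t j <;> by_cases hD : σ.symm j ∈ D <;> simp_all

theorem isTwoFactor_exchange_ringGraph (hσ : ∀ i, σ i ≠ i) (hσ2 : ∀ i, σ (σ i) ≠ i)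
    (hi : i ∈ D) (hi' : σ.symm i ∈ D) (hD : ∀ j, j ≠ i → (j ∈ D ↔ σ.symm j ∉ D))
    (ht : ∀ j ∈ D, t (σ j) = π j (t j)) (hpq : p ≠ q) (hp : p ≠ t i) (hq : q ≠ t i) :
    IsTwoFactor
      (exchange (ringGraph σ π) (.inr (i, p)) (.inr (σ i, π i p)) (.inr (i, q)) (.inr (σ i, π i q)))
      (singleStrandGraph σ π D t ⊔ SimpleGraph.fromEdgeSet {s(.inr (i, p), .inr (i, q))}) := by
  have hne : (Sum.inr (i, p) : ι ⊕ ι × Fin 3) ≠ .inr (i, q) := by simp [hpq]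
  have hdel {r : Fin 3} (hr : r ≠ t i) :
      ¬ (singleStrandGraph σ π D t).Adj (.inr (i, r)) (.inr (σ i, π i r)) := by
    rw [singleStrandGraph, ringSubgraph_adj_strand_strand hσ]
    rintro (⟨-, -, h⟩ | ⟨h, -⟩)
    · exact hr (h hi)
    · exact hσ2 i h.symm
  refine ⟨?_, ?_⟩
  · intro v w hvw
    rw [exchange_adj]
    rcases hvw with hvw | hvw
    · refine .inl ⟨ringSubgraph_le hvw, fun h => ?_, fun h => ?_⟩
      · rw [← SimpleGraph.mem_edgeSet, h] at hvw
        exact hdel hp hvw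
      · rw [← SimpleGraph.mem_edgeSet, h] at hvw
        exact hdel hq hvw
    · rw [SimpleGraph.fromEdgeSet_adj] at hvw
      exact .inr ⟨.inl hvw.1, hvw.2⟩
  · intro v
    by_cases hvp : v = .inr (i, p)
    · subst hvp
      rw [neighborSet_sup_fromEdgeSet_self hne, neighborSet_singleStrandGraph hσ hi hi' ht hp]
      exact Set.ncard_pair Sum.inr_ne_inl
    by_cases hvq : v = .inr (i, q)
    · subst hvq
      rw [Sym2.eq_swap, neighborSet_sup_fromEdgeSet_self hne.symm,
        neighborSet_singleStrandGraph hσ hi hi' ht hq]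
      exact Set.ncard_pair Sum.inr_ne_inl
    rw [neighborSet_sup_fromEdgeSet hvp hvq]
    rcases v with j | ⟨j, s⟩
    · exact ncard_neighborSet_hub (r := t j) fun s => Iff.rfl
    by_cases hj : j = i
    · subst hj
      -- With the ends `p` and `q` treated, only the strand running straight through the claw is
      -- left.
      have hs : s = t j := by
        have h1 : s ≠ p := fun h => hvp (by rw [h])
        have h2 : s ≠ q := fun h => hvq (by rw [h])
        generalize t j = r at *
        clear * - h1 h2 hpq hp hq
        revert s p q r; decide
      subst hs
      apply ncard_neighborSet_strand hσ hσ2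
      refine .inr (.inr ⟨by simp, fun _ => rfl, fun h => ?_⟩)
      rw [Equiv.symm_apply_eq, ← ht _ h, Equiv.apply_symm_apply]
    · exact ncard_neighborSet_singleStrandGraph hσ hσ2 (hD j hj) ht s

theorem not_isGadgetPair_link_link_same (hσ : ∀ i, σ i ≠ i) (hσ2 : ∀ i, σ (σ i) ≠ i)
    (hi : i ∈ D) (hi' : σ.symm i ∈ D) (hD : ∀ j, j ≠ i → (j ∈ D ↔ σ.symm j ∉ D))
    (ht : ∀ j ∈ D, t (σ j) = π j (t j)) (hpq : p ≠ q) (hp : p ≠ t i) (hq : q ≠ t i) :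
    ¬ IsGadgetPair (ringGraph σ π) (.inr (i, p)) (.inr (σ i, π i p)) (.inr (i, q))
      (.inr (σ i, π i q)) := by
  intro hg
  have hne : (Sum.inr (i, p) : ι ⊕ ι × Fin 3) ≠ .inr (i, q) := by simp [hpq]
  set F := singleStrandGraph σ π D t ⊔ SimpleGraph.fromEdgeSet {s(.inr (i, p), .inr (i, q))}
    with hFdef
  have hF : IsTwoFactor _ F := isTwoFactor_exchange_ringGraph hσ hσ2 hi hi' hD ht hpq hp hq
  have hcross : F.edgeSet ∩ crossEdges (.inr (i, p)) (.inr (σ i, π i p)) (.inr (i, q))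
      (.inr (σ i, π i q)) = {s(.inr (i, p), .inr (i, q))} := by
    ext e
    simp only [Set.mem_inter_iff, crossEdges, Set.mem_insert_iff, Set.mem_singleton_iff]
    constructor
    · rintro ⟨he, rfl | rfl | rfl | rfl⟩
      · rfl
      -- Each other cross edge either joins different strands across the gap or joins two ends of
      -- claw `σ i`, so `F` contains none of them.
      all_goals
        exfalso
        simp only [hFdef, SimpleGraph.mem_edgeSet, SimpleGraph.sup_adj, singleStrandGraph,
          ringSubgraph_adj_strand_strand hσ, SimpleGraph.fromEdgeSet_adj, Set.mem_singleton_iff,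
          Sym2.eq_iff, Sum.inr.injEq, Prod.mk.injEq, hσ i, (hσ (σ i)).symm,
          (hσ2 i).symm, (π i).injective.eq_iff, hpq, hpq.symm, false_and, and_false, or_false]
          at he
    · rintro rfl
      refine ⟨?_, .inl rfl⟩
      rw [SimpleGraph.mem_edgeSet]
      exact .inr ((SimpleGraph.fromEdgeSet_adj _).2 ⟨rfl, hne⟩)
  have h1 : F.Adj (.inl i) (.inr (i, p)) := .inl (ringSubgraph_adj_hub_strand.2 ⟨rfl, hp⟩)
  have h2 : F.Adj (.inr (i, p)) (.inr (i, q)) :=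
    .inr ((SimpleGraph.fromEdgeSet_adj _).2 ⟨rfl, hne⟩)
  have h3 : F.Adj (.inr (i, q)) (.inl i) := .inl (ringSubgraph_adj_strand_hub.2 ⟨rfl, hq⟩)
  -- The triangle through the hub and the cross edge is an odd cycle.
  have := (hg.cross F hF _ hcross _ (.cons h1 (.cons h2 (.cons h3 .nil))) ?_).1 (by simp)
  · simp [Nat.even_iff] at this
  · simp [SimpleGraph.Walk.cons_isCycle_iff, hpq]

/-- The gaps of a cyclic arrangement can be chosen alternately, except that two consecutive ones
are chosen around `i`. -/
def HasAlternatingSets (σ : Equiv.Perm ι) : Prop :=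
  ∀ i, ∃ D : Set ι, i ∈ D ∧ σ.symm i ∈ D ∧ ∀ j, j ≠ i → (j ∈ D ↔ σ.symm j ∉ D)

theorem exists_strand (hσ : ∀ i, σ i ≠ i) (hσ2 : ∀ i, σ (σ i) ≠ i) (hi : i ∈ D)
    (hi' : σ.symm i ∈ D) (hD : ∀ j, j ≠ i → (j ∈ D ↔ σ.symm j ∉ D)) (r : Fin 3) :
    ∃ t : ι → Fin 3, t i = r ∧ ∀ j ∈ D, t (σ j) = π j (t j) := by
  classical
  -- Following strands forces `t` only along the run `σ.symm i`, `i`, `σ i`, where `r` determines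
  -- it. Every other gap in `D` is isolated, so strand 0 can be chosen at its left claw and carried
  -- across.
  refine ⟨fun j => if j = σ.symm i then (π j).symm r else if j = i then r else
    if j = σ i then π i r else if σ.symm j ∈ D then π (σ.symm j) 0 else 0, ?_, fun j hj => ?_⟩
  · have : i ≠ σ.symm i := fun h => hσ i ((Equiv.eq_symm_apply σ).1 h)
    simp [this]
  · by_cases h1 : j = σ.symm i
    · subst h1
      have : i ≠ σ.symm i := fun h => hσ i ((Equiv.eq_symm_apply σ).1 h)
      simp [this]
    · have h1' : σ j ≠ i := fun h => h1 ((Equiv.eq_symm_apply σ).2 h)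
      by_cases h2 : j = i
      · subst h2
        have : σ j ≠ σ.symm j := fun h => hσ2 j ((Equiv.eq_symm_apply σ).1 h)
        simp [this, h1, h1']
      · have h3 : σ.symm j ∉ D := (hD j h2).1 hj
        have h4 : j ≠ σ i := by rintro rfl; exact h3 (by simpa using hi)
        have h5 : σ j ≠ σ.symm i := by
          intro h
          have hji : σ j ∉ D := (hD (σ j) h1').not.2 (by simpa using hj)
          exact hji (h ▸ hi')
        simp [h1, h1', h2, h3, h4, h5, hj]

theorem not_isGadgetPair_of_ringEdge [Finite ι] (hσ : ∀ i, σ i ≠ i) (hσ2 : ∀ i, σ (σ i) ≠ i)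
    (hσ3 : ∀ i, σ (σ (σ i)) ≠ i) (hσ4 : ∀ i, σ (σ (σ (σ i))) ≠ i) (hD : HasAlternatingSets σ)
    {spk lnk : ι → Fin 3 → Prop} {a b c d : ι ⊕ ι × Fin 3} (hab : RingEdge σ π spk lnk a b)
    (hcd : RingEdge σ π spk lnk c d) : ¬ IsGadgetPair (ringGraph σ π) a b c d := by
  intro hg
  have hspoke {x : ι → Fin 3} {i : ι} {s : Fin 3}
      (h : x i ≠ s ∧ π (σ.symm i) (x (σ.symm i)) ≠ s) :
      ¬ (ringSubgraph σ π (fun i s => s = x i ∨ s = π (σ.symm i) (x (σ.symm i)))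
        (fun i s => s ≠ x i)).Adj (.inl i) (.inr (i, s)) := by
    rw [ringSubgraph_adj_hub_strand]
    rintro ⟨-, h' | h'⟩
    exacts [h.1 h'.symm, h.2 h'.symm]
  have hlink {x : ι → Fin 3} {i : ι} {s : Fin 3} (h : x i = s) :
      ¬ (ringSubgraph σ π (fun i s => s = x i ∨ s = π (σ.symm i) (x (σ.symm i)))
        (fun i s => s ≠ x i)).Adj (.inr (i, s)) (.inr (σ i, π i s)) := by
    rw [ringSubgraph_adj_strand_strand hσ]
    rintro (⟨-, -, h'⟩ | ⟨h', -⟩)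
    exacts [h' h.symm, hσ2 i h'.symm]
  have hind := hg.independent
  have hspoke_link {i j : ι} {s q : Fin 3} (hg : IsGadgetPair (ringGraph σ π) (.inl i)
      (.inr (i, s)) (.inr (j, q)) (.inr (σ j, π j q))) : False := by
    obtain ⟨-, -, h1, h2⟩ := hg.independent
    obtain ⟨x, hx, hs, hs', hq⟩ := exists_proper_spoke_link (π := π) hσ hσ2 hσ3 (i := i) (j := j)
      (s := s) (q := q) (by rintro rfl rfl; exact h1 rfl) (by rintro rfl rfl; exact h2 rfl)
    exact hg.not_avoid _ (isTwoFactor_ringSubgraph hσ hσ2 hx) ⟨hspoke ⟨hs, hs'⟩, hlink hq⟩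
  cases hab with
  | spoke i s =>
    cases hcd with
    | spoke j u =>
      have hij : i ≠ j := by rintro rfl; exact hind.1 rfl
      obtain ⟨x, hx, hs, hu⟩ := exists_proper_spoke_spoke (π := π) hσ hσ2 hσ3 hσ4 s u hij
      exact hg.not_avoid _ (isTwoFactor_ringSubgraph hσ hσ2 hx) ⟨hspoke hs, hspoke hu⟩
    | link j q => exact hspoke_link hg
  | link i p =>
    cases hcd with
    | spoke j u => exact hspoke_link hg.symm
    | link j q =>
      by_cases hij : i = j
      · subst hij
        have hpq : p ≠ q := by rintro rfl; exact hind.1 rfl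
        -- The third strand `r` will be the one that passes claw `i`.
        obtain ⟨r, hp, hq⟩ : ∃ r : Fin 3, p ≠ r ∧ q ≠ r := by
          clear * -
          revert p q; decide
        obtain ⟨D, hi, hi', hDi⟩ := hD i
        obtain ⟨t, rfl, ht⟩ := exists_strand (π := π) hσ hσ2 hi hi' hDi r
        exact not_isGadgetPair_link_link_same hσ hσ2 hi hi' hDi ht hpq hp hq hg
      · obtain ⟨x, hx, hp, hq⟩ := exists_proper_link_link (π := π) hσ (p := p) (q := q) hij
          (by rintro rfl rfl; exact hind.2.2.1 rfl) (by rintro rfl rfl; exact hind.2.1 rfl)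
        exact hg.not_avoid _ (isTwoFactor_ringSubgraph hσ hσ2 hx) ⟨hlink hp, hlink hq⟩

theorem not_hasGadgetPair_ringGraph [Finite ι] (hσ : ∀ i, σ i ≠ i) (hσ2 : ∀ i, σ (σ i) ≠ i)
    (hσ3 : ∀ i, σ (σ (σ i)) ≠ i) (hσ4 : ∀ i, σ (σ (σ (σ i))) ≠ i) (hD : HasAlternatingSets σ) :
    ¬ HasGadgetPair (ringGraph σ π) := by
  rintro ⟨a, b, c, d, h⟩
  have key {a b c d} (hab : RingEdge σ π (fun _ _ => True) (fun _ _ => True) a b)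
      (hcd : RingEdge σ π (fun _ _ => True) (fun _ _ => True) c d) :=
    not_isGadgetPair_of_ringEdge hσ hσ2 hσ3 hσ4 hD hab hcd
  rcases ((SimpleGraph.fromRel_adj _ _ _).1 h.adj_ab).2 with hab | hab <;>
    rcases ((SimpleGraph.fromRel_adj _ _ _).1 h.adj_cd).2 with hcd | hcd
  · exact key hab hcd h
  · exact key hab hcd h.swap_right
  · exact key hab hcd h.swap_left
  · exact key hab hcd h.swap_left.swap_right

end RingGadget

/-! ### The Flower snark as a ring of claws -/

section Flower

variable {t : ℕ}

/-- The vertices of the Flower snark as hubs and ends of claws. -/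
def flowerVertexEquiv (t : ℕ) : FlowerVertex t ≃ Fin t ⊕ Fin t × Fin 3 where
  toFun
    | .h i => .inl i
    | .u i => .inr (i, 0)
    | .v i => .inr (i, 1)
    | .w i => .inr (i, 2)
  invFun
    | .inl i => .h i
    | .inr (i, 0) => .u i
    | .inr (i, 1) => .v i
    | .inr (i, 2) => .w i
  left_inv x := by cases x <;> rfl
  right_inv x := by
    rcases x with i | ⟨i, s⟩
    · rfl
    · fin_cases s <;> rfl

/-- The strands are exchanged in the last gap of the Flower snark. -/
def flowerTwist (i : Fin t) : Equiv.Perm (Fin 3) :=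
  if i.val + 1 = t then Equiv.swap 0 1 else 1

variable [NeZero t]

theorem val_addRight_one (i : Fin t) :
    (Equiv.addRight (1 : Fin t) i).val = if i.val + 1 = t then 0 else i.val + 1 := by
  have hi := i.2
  rw [Equiv.coe_addRight, Fin.val_add, Fin.val_one', Nat.add_mod_mod]
  split_ifs with h
  · rw [h, Nat.mod_self]
  · exact Nat.mod_eq_of_lt (by omega)

theorem ringEdge_of_flowerEdge {x y : FlowerVertex t} (h : FlowerEdge t x y) :
    RingEdge (Equiv.addRight (1 : Fin t)) flowerTwist (fun _ _ => True) (fun _ _ => True)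
      (flowerVertexEquiv t x) (flowerVertexEquiv t y) := by
  have hlink {i j : Fin t} {s u : Fin 3} (hj : j.val = if i.val + 1 = t then 0 else i.val + 1)
      (hu : u = flowerTwist i s) : RingEdge (Equiv.addRight (1 : Fin t)) flowerTwist
        (fun _ _ => True) (fun _ _ => True) (.inr (i, s)) (.inr (j, u)) := by
    obtain rfl : j = Equiv.addRight 1 i := Fin.ext (by rw [hj, val_addRight_one])
    subst hu
    exact .link i s trivial
  cases h with
  | hu i => exact .spoke i 0 trivial
  | hv i => exact .spoke i 1 trivial
  | hw i => exact .spoke i 2 trivial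
  | uu i j h | vv i j h | ww i j h =>
    have hi : i.val + 1 ≠ t := by have := j.2; omega
    exact hlink (by rw [if_neg hi, h]) (by rw [flowerTwist, if_neg hi]; rfl)
  | uv i j hi hj | vu i j hi hj | wrap i j hi hj =>
    exact hlink (by rw [if_pos hi, hj]) (by rw [flowerTwist, if_pos hi]; decide)

theorem flowerEdge_of_ringEdge {x y : Fin t ⊕ Fin t × Fin 3}
    (h : RingEdge (Equiv.addRight (1 : Fin t)) flowerTwist (fun _ _ => True) (fun _ _ => True) x y) :
    FlowerEdge t ((flowerVertexEquiv t).symm x) ((flowerVertexEquiv t).symm y) := by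
  cases h with
  | spoke i s =>
    fin_cases s
    exacts [.hu i, .hv i, .hw i]
  | link i s =>
    have hval := val_addRight_one i
    generalize Equiv.addRight (1 : Fin t) i = j at *
    by_cases hi : i.val + 1 = t
    · rw [if_pos hi] at hval
      rw [flowerTwist, if_pos hi]
      fin_cases s
      exacts [.uv i j hi hval, .vu i j hi hval, .wrap i j hi hval]
    · rw [if_neg hi] at hval
      rw [flowerTwist, if_neg hi]
      fin_cases s
      exacts [.uu i j hval.symm, .vv i j hval.symm, .ww i j hval.symm]

/-- The Flower snark is a cyclic arrangement of claws. -/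
def flowerIso (t : ℕ) [NeZero t] :
    flowerSnark t ≃g ringGraph (Equiv.addRight (1 : Fin t)) flowerTwist where
  toEquiv := flowerVertexEquiv t
  map_rel_iff' {x y} := by
    have hiff (x y : FlowerVertex t) : RingEdge (Equiv.addRight (1 : Fin t)) flowerTwist
        (fun _ _ => True) (fun _ _ => True) (flowerVertexEquiv t x) (flowerVertexEquiv t y) ↔
          FlowerEdge t x y :=
      ⟨fun h => by simpa using flowerEdge_of_ringEdge h, ringEdge_of_flowerEdge⟩
    rw [ringGraph, ringSubgraph, flowerSnark, SimpleGraph.fromRel_adj, SimpleGraph.fromRel_adj,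
      hiff, hiff, (flowerVertexEquiv t).injective.ne_iff]

theorem hasAlternatingSets_addRight_one (ht : Odd t) :
    HasAlternatingSets (Equiv.addRight (1 : Fin t)) := by
  intro i
  have ht' := Nat.odd_iff.1 ht
  -- These are the gaps at even distance from `i` going forward round the ring; past the wrap that
  -- distance is `t` minus the backward one, so for odd `t` the parity flips. The predecessor of `i`
  -- is at distance `t - 1`, which is even.
  refine ⟨{j | i.val ≤ j.val ∧ (j.val - i.val) % 2 = 0 ∨ j.val < i.val ∧ (i.val - j.val) % 2 = 1},
    ?_, ?_, fun j hj => ?_⟩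
  · exact .inl ⟨le_rfl, by simp⟩
  · obtain ⟨k, rfl⟩ := (Equiv.addRight (1 : Fin t)).surjective i
    have hk := val_addRight_one k
    have := k.2
    rw [Equiv.symm_apply_apply, Set.mem_ofPred_eq]
    split_ifs at hk <;> omega
  · obtain ⟨k, rfl⟩ := (Equiv.addRight (1 : Fin t)).surjective j
    have hk := val_addRight_one k
    have hki := Fin.val_ne_of_ne hj
    have := k.2
    have := i.2
    rw [Equiv.symm_apply_apply, Set.mem_ofPred_eq, Set.mem_ofPred_eq]
    split_ifs at hk <;> omega

theorem not_hasGadgetPair_flowerSnark (ht : Odd t) (ht5 : 5 ≤ t) :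
    ¬ HasGadgetPair (flowerSnark t) := by
  rintro ⟨a, b, c, d, h⟩
  have hval := val_addRight_one (t := t)
  refine not_hasGadgetPair_ringGraph (σ := Equiv.addRight (1 : Fin t)) (fun i hi => ?_)
    (fun i hi => ?_) (fun i hi => ?_) (fun i hi => ?_) (hasAlternatingSets_addRight_one ht)
    ⟨_, _, _, _, h.map (flowerIso t)⟩
  -- As `t ≥ 5`, no rotation by one to four steps has a fixed point.
  all_goals
    have hi' := congrArg Fin.val hi
    have := i.2
    simp only [hval] at hi'
    split_ifs at hi' <;> omega

end Flower

end OddTwoFactor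

theorem lemma5p2 :
    (¬ OddTwoFactor.HasGadgetPair OddTwoFactor.P18 ∧
      ¬ OddTwoFactor.HasGadgetPair OddTwoFactor.P26 ∧
      ¬ OddTwoFactor.HasGadgetPair OddTwoFactor.P34) ∧
    (∀ t : ℕ, Odd t → 5 ≤ t → ¬ OddTwoFactor.HasGadgetPair (OddTwoFactor.flowerSnark t)) :=
  ⟨⟨OddTwoFactor.not_hasGadgetPair_P18, OddTwoFactor.not_hasGadgetPair_P26,
    OddTwoFactor.not_hasGadgetPair_P34⟩, fun t ht ht5 =>
    have : NeZero t := ⟨by omega⟩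
    OddTwoFactor.not_hasGadgetPair_flowerSnark ht ht5⟩
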